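/- Let $K$ be a field with $\operatorname{char}K=2$, let $n\ge 2$, let $\mathbf a=(a_1,\dots,a_n)$ be integers with all $a_i\ge 2$, and let $\mathbf q=(q_{ij})$ be an $n\times n$ matrix over $K$ with $q_{ii}=1$ and $q_{ij}q_{ji}=1$ for all $i,j$. Let $$A=A(\mathbf q,\mathbf a)=K\langle x_1,\dots,x_n\rangle/\langle x_i^{a_i},\ x_jx_i-q_{ij}x_ix_j,\ 1\le i,j\le n\rangle$$ be the quantum complete intersection, with standard basis $\{x_{\mathbf v}=x_1^{v_1}\cdots x_n^{v_n}\mid \mathbf v\in V\}$, $V=\{\mathbf v\in\mathbb N_0^n\mid v_i\le a_i-1\}$, and dual basis $\{x_{\mathbf v}^*\}$. Write $\mathbf a-\mathbf 1=(a_1-1,\dots,a_n-1)$. Definitions. A *bi-Frobenius algebra structure* $(A,\phi,t,S)$ on a finite-dimensional algebra $A$ consists of a coalgebra structure $(\Delta,\varepsilon)$ on the vector space $A$, a linear form $\phi\in A^*$ and an element $t\in A$ such that: $\varepsilon$ is an algebra homomorphism and $1$ is group-like; every element of $A^*$ is of the form $x\mapsto\phi(xz)$ with $z\in A$; every element of $A$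 is of the form $\sum f(t_1)t_2$ with $f\in A^*$; and the linear map $S(a)=\sum\phi(t_1a)t_2$ (the antipode) is an algebra anti-homomorphism and a coalgebra anti-homomorphism. For $A=A(\mathbf q,\mathbf a)$, $S$ is a *permutation antipode* if there are a permutation $\sigma$ of $V$ and scalars $c_{\mathbf v}\in K$ with $S(x_{\mathbf v})=c_{\mathbf v}x_{\sigma(\mathbf v)}$ for all $\mathbf v\in V$. The *canonical Nakayama automorphism* of $A$ is the unique algebra automorphism $\mathcal N$ with $x_{\mathbf a-\mathbf 1}^*(xy)=x_{\mathbf a-\mathbf 1}^*(y\,\mathcal N(x))$ for all $x,y\in A$. A permutation $\pi\in S_n$ is *compatible* if $a_{\pi(i)}=a_i$ and $q_{\pi(i)\pi(j)}=q_{ji}$ for all $i,j$; it acts on $\mathbb Z^n$ by $\pi(\mathbf v)=(v_{\pi^{-1}(1)},\dots,v_{\pi^{-1}(n)})$. The algebra $A$ is *symmetric* if $A\cong A^*$ as $A$-$A$-bimodules. For $\mathbf u,\mathbf v\in\mathbb Z^n$ put $\mathbf q^{\langle\mathbf u|\mathbf v\rangle}=\prod_{i<j}q_{ij}^{u_jv_i}$,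 and let $\mathbf e_i$ be the $i$-th unit vector. Statement. $A$ admits a bi-Frobenius algebra structure with permutation antipode if and only if $\mathcal N^2=\mathrm{Id}$ and there is a compatible permutation $\pi\in S_n$ with $\pi^2=\mathrm{Id}$. If this is the case, then $A$ is symmetric, and for every compatible $\pi\in S_n$ with $\pi^2=\mathrm{Id}$, $(A,\ x_{\mathbf a-\mathbf 1}^*,\ x_{\mathbf a-\mathbf 1},\ S)$ is a bi-Frobenius algebra with permutation antipode, where the coalgebra structure is given by $\varepsilon(x_{\mathbf v})=\delta_{\mathbf v,\mathbf 0}$, $\Delta(1)=1\otimes1$, $\Delta(x_{\mathbf v})=1\otimes x_{\mathbf v}+x_{\mathbf v}\otimes1$ for $\mathbf v\in V\setminus\{\mathbf 0,\mathbf a-\mathbf 1\}$, and $$\Delta(x_{\mathbf a-\mathbf 1})=\sum_{\mathbf v\in V}\frac{1}{\mathbf q^{\langle\mathbf a-\mathbf 1-\mathbf v|\mathbf v\rangle}}\Big(\prod_{1\le j<k\le n}\big(\mathbf q^{\langle\pi(\mathbf e_k)|\pi(\mathbf e_j)\rangle}\big)^{v_jv_k}\Big)\,x_{\mathbf a-\mathbf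 1-\mathbf v}\otimes x_{\pi(\mathbf v)},$$ and $S$ is given by $$S(x_{\mathbf v})=\prod_{1\le j<k\le n}\big(\mathbf q^{\langle\pi(\mathbf e_k)|\pi(\mathbf e_j)\rangle}\big)^{v_jv_k}\,x_{\pi(\mathbf v)},\qquad \mathbf v\in V.$$ In particular $S(x_i)=x_{\pi(i)}$ for $1\le i\le n$. -/

import Mathlib

open scoped TensorProduct

/-! ### Frobenius algebras, Frobenius coalgebras, symmetric algebras, bi-Frobenius algebras -/

section Frobenius

variable (K : Type*) {A : Type*} [Field K] [Ring A] [Algebra K A]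

/-- `φ` is a Frobenius homomorphism of `A`: every linear form on `A` is `z ⇀ φ = φ(- * z)`
for some `z ∈ A`, i.e. `A^* = A ⇀ φ`. -/
def IsFrobeniusHom (φ : Module.Dual K A) : Prop :=
  ∀ f : Module.Dual K A, ∃ z : A, ∀ x : A, f x = φ (x * z)

/-- `N` is the Nakayama automorphism of `A` with respect to `φ`: `φ(xy) = φ(y N(x))`.
For a Frobenius homomorphism `φ` there is exactly one such `N`. -/
def IsNakayamaAutomorphism (φ : Module.Dual K A) (N : A ≃ₐ[K] A) : Prop :=
  ∀ x y : A, φ (x * y) = φ (y * N x)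

variable (A) in
/-- `A` is a symmetric algebra: `A ≅ A^*` as `A`-`A`-bimodules, where
`(a ⇀ f ↼ b)(y) = f(b y a)`. -/
def IsBimoduleSymmetric : Prop :=
  ∃ e : A ≃ₗ[K] Module.Dual K A, ∀ a b x y : A, e (a * x * b) y = e x (b * y * a)

/-- The element `∑ f(c₁) c₂` for a linear form `f` and a tensor `∑ c₁ ⊗ c₂`. -/
noncomputable def tensorContract (f : Module.Dual K A) (w : A ⊗[K] A) : A :=
  TensorProduct.lid K A (LinearMap.rTensor A f w)

variable (A) in
/-- A bi-Frobenius algebra structure `(A, φ, t, S)` on a finite-dimensional `K`-algebra `A`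
(the algebra structure of `A` is the given one; the coalgebra structure is part of the data). -/
structure BiFrobeniusStructure [FiniteDimensional K A] extends Coalgebra K A where
  φ : Module.Dual K A
  t : A
  S : A →ₗ[K] A
  /-- `S(a) = ∑ φ(t₁ a) t₂`. -/
  S_eq : ∀ a : A, S a = tensorContract K (φ ∘ₗ LinearMap.mulRight K a) (comul t)
  /-- the counit is an algebra homomorphism -/
  counit_one : counit 1 = 1
  counit_mul : ∀ a b : A, counit (a * b) = counit a * counit b
  /-- `1` is group-like (together with `counit_one`) -/
  comul_one : comul 1 = 1 ⊗ₜ[K] 1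
  /-- `(A, φ)` is a Frobenius algebra -/
  frobenius : IsFrobeniusHom K φ
  /-- `(A, t)` is a Frobenius coalgebra: `A = t ↼ A^*`, where `t ↼ f = ∑ f(t₁) t₂` -/
  cofrobenius : ∀ a : A, ∃ f : Module.Dual K A, tensorContract K f (comul t) = a
  /-- `S` is an algebra anti-homomorphism -/
  S_one : S 1 = 1
  S_mul : ∀ a b : A, S (a * b) = S b * S a
  /-- `S` is a coalgebra anti-homomorphism -/
  counit_S : ∀ a : A, counit (S a) = counit a
  comul_S : ∀ a : A, comul (S a) = TensorProduct.map S S (TensorProduct.comm K A A (comul a))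

end Frobenius

/-! ### Quantum complete intersections -/

/-- The parameters `(q, a)` of a quantum complete intersection in `n ≥ 2` variables. -/
structure QCIData (K : Type*) [Field K] (n : ℕ) where
  a : Fin n → ℕ
  q : Matrix (Fin n) (Fin n) K
  two_le_n : 2 ≤ n
  two_le_a : ∀ i, 2 ≤ a i
  q_self : ∀ i, q i i = 1
  q_mul_q : ∀ i j, q i j * q j i = 1

namespace QCIData

variable {K : Type*} [Field K] {n : ℕ} (D : QCIData K n)

/-- The defining relations `x_i^{a_i} = 0` and `x_j x_i = q_{ij} x_i x_j`. -/
inductive Rel : FreeAlgebra K (Fin n) → FreeAlgebra K (Fin n) → Prop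
  | pow (i : Fin n) : Rel (FreeAlgebra.ι K i ^ D.a i) 0
  | comm (i j : Fin n) : Rel (FreeAlgebra.ι K j * FreeAlgebra.ι K i)
      (D.q i j • (FreeAlgebra.ι K i * FreeAlgebra.ι K j))

/-- The quantum complete intersection `A(q, a)`. -/
def Alg : Type _ := RingQuot D.Rel

noncomputable instance : Ring D.Alg := inferInstanceAs (Ring (RingQuot D.Rel))
noncomputable instance : Algebra K D.Alg := inferInstanceAs (Algebra K (RingQuot D.Rel))

/-- The quotient map from the free algebra. -/
noncomputable def proj : FreeAlgebra K (Fin n) →ₐ[K] D.Alg := RingQuot.mkAlgHom K D.Rel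

/-- The generator `x_i`. -/
noncomputable def x (i : Fin n) : D.Alg := D.proj (FreeAlgebra.ι K i)

/-- The monomial `x_v = x_1^{v_1} ⋯ x_n^{v_n}`, for `v ∈ ℕ^n`. -/
noncomputable def mon (v : Fin n → ℕ) : D.Alg :=
  ((List.finRange n).map fun i => D.x i ^ v i).prod

/-- The index set `V = {v | v_i ≤ a_i - 1}` of the standard basis. -/
abbrev V : Type := (i : Fin n) → Fin (D.a i)

/-- The underlying vector in `ℕ^n` of an element of `V`. -/
def vec (v : D.V) : Fin n → ℕ := fun i => (v i : ℕ)

/-- The element `0` of `V`. -/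
def bot : D.V := fun i => ⟨0, by have := D.two_le_a i; omega⟩

/-- The element `a - 1` of `V`. -/
def top : D.V := fun i => ⟨D.a i - 1, by have := D.two_le_a i; omega⟩

/-! #### The standard basis -/

theorem x_pow (i : Fin n) : D.x i ^ D.a i = 0 := by
  have h := RingQuot.mkAlgHom_rel K (Rel.pow (D := D) i)
  rw [map_pow, map_zero] at h
  exact h

theorem x_mul_x (i j : Fin n) : D.x j * D.x i = D.q i j • (D.x i * D.x j) := by
  have h := RingQuot.mkAlgHom_rel K (Rel.comm (D := D) i j)
  rw [map_mul, map_smul, map_mul] at h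
  exact h

theorem mon_eq_zero (v : Fin n → ℕ) (i : Fin n) (h : D.a i ≤ v i) : D.mon v = 0 := by
  refine List.prod_eq_zero (List.mem_map.2 ⟨i, List.mem_finRange i, ?_⟩)
  rw [← Nat.add_sub_cancel' h, pow_add, x_pow, zero_mul]

theorem x_mul_pow (i k : Fin n) (m : ℕ) :
    D.x i * D.x k ^ m = D.q k i ^ m • (D.x k ^ m * D.x i) := by
  induction m with
  | zero => simp
  | succ m ih =>
    rw [pow_succ, ← mul_assoc, ih, smul_mul_assoc, mul_assoc, x_mul_x, mul_smul_comm, smul_smul,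
      ← mul_assoc, pow_succ]

theorem x_mul_list (i : Fin n) (v : Fin n → ℕ) (l : List (Fin n)) (hl : l.Nodup) (hi : i ∈ l) :
    ∃ c : K, D.x i * (l.map fun k => D.x k ^ v k).prod =
      c • (l.map fun k => D.x k ^ (v + Pi.single i 1 : Fin n → ℕ) k).prod := by
  induction l with
  | nil => simp at hi
  | cons k l ih =>
    rw [List.nodup_cons] at hl
    by_cases hk : i = k
    · subst hk
      refine ⟨1, ?_⟩
      have : (l.map fun k => D.x k ^ (v + Pi.single i 1 : Fin n → ℕ) k) = l.map fun k => D.x k ^ v k := by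
        refine List.map_congr_left fun j hj => ?_
        have : j ≠ i := fun h => hl.1 (h ▸ hj)
        simp [this]
      rw [List.map_cons, List.map_cons, List.prod_cons, List.prod_cons, this, one_smul,
        ← mul_assoc]
      simp [pow_succ']
    · obtain ⟨c, hc⟩ := ih hl.2 (by simpa [hk] using hi)
      refine ⟨D.q k i ^ v k * c, ?_⟩
      rw [List.map_cons, List.map_cons, List.prod_cons, List.prod_cons, ← mul_assoc, x_mul_pow,
        smul_mul_assoc, mul_assoc, hc, mul_smul_comm, smul_smul]
      simp [Ne.symm hk]

theorem x_mul_mon (i : Fin n) (v : Fin n → ℕ) :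
    ∃ c : K, D.x i * D.mon v = c • D.mon (v + Pi.single i 1) :=
  D.x_mul_list i v _ (List.nodup_finRange n) (List.mem_finRange i)

theorem mon_mem (v : Fin n → ℕ) :
    D.mon v ∈ Submodule.span K (Set.range fun v : D.V => D.mon (D.vec v)) := by
  by_cases h : ∃ i, D.a i ≤ v i
  · obtain ⟨i, hi⟩ := h
    rw [D.mon_eq_zero v i hi]
    exact zero_mem _
  · push Not at h
    exact Submodule.subset_span ⟨fun i => ⟨v i, h i⟩, rfl⟩

theorem proj_mul_mem (w : FreeAlgebra K (Fin n)) : ∀ z : D.Alg,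
    z ∈ Submodule.span K (Set.range fun v : D.V => D.mon (D.vec v)) →
    D.proj w * z ∈ Submodule.span K (Set.range fun v : D.V => D.mon (D.vec v)) := by
  induction w using FreeAlgebra.induction with
  | grade0 r =>
    intro z hz
    rw [AlgHom.commutes, ← Algebra.smul_def]
    exact Submodule.smul_mem _ _ hz
  | grade1 i =>
    intro z hz
    induction hz using Submodule.span_induction with
    | mem z hz =>
      obtain ⟨v, rfl⟩ := hz
      obtain ⟨c, hc⟩ := D.x_mul_mon i (D.vec v)
      change D.x i * D.mon (D.vec v) ∈ _
      rw [hc]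
      exact Submodule.smul_mem _ _ (D.mon_mem _)
    | zero => simp
    | add y z _ _ hy hz => rw [mul_add]; exact add_mem hy hz
    | smul c z _ hz => rw [mul_smul_comm]; exact Submodule.smul_mem _ _ hz
  | mul w w' hw hw' =>
    intro z hz
    rw [map_mul, mul_assoc]
    exact hw _ (hw' _ hz)
  | add w w' hw hw' =>
    intro z hz
    rw [map_add, add_mul]
    exact add_mem (hw _ hz) (hw' _ hz)

theorem span_mon :
    ⊤ ≤ Submodule.span K (Set.range fun v : D.V => D.mon (D.vec v)) := by
  intro z _
  obtain ⟨w, rfl⟩ := RingQuot.mkAlgHom_surjective K D.Rel z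
  have h := D.proj_mul_mem w (D.mon 0) (D.mon_mem 0)
  have h1 : D.mon 0 = 1 := by simp [mon]
  rw [h1, mul_one] at h
  exact h

/-- The coefficient `∏_{k < i} q_{ki}^{v_k}`, with `x_i x_v` equal to this multiple of
`x_{v + e_i}`. -/
def coef (i : Fin n) (v : Fin n → ℕ) : K := ∏ k ∈ Finset.Iio i, D.q k i ^ v k

theorem coef_add (i j : Fin n) (v : Fin n → ℕ) :
    D.coef i (v + Pi.single j 1) = D.coef i v * if j < i then D.q j i else 1 := by
  have : ∀ k, D.q k i ^ (v + Pi.single j 1 : Fin n → ℕ) k = D.q k i ^ v k * if k = j then D.q j i else 1 := by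
    intro k
    by_cases h : k = j
    · subst h; simp [pow_succ]
    · simp [h]
  simp only [coef, this, Finset.prod_mul_distrib, Finset.prod_ite_eq', Finset.mem_Iio]

/-- Left multiplication by `x_i` on the space with basis `ℕ^n`, truncated at `v_i = a_i`. -/
noncomputable def op (i : Fin n) : Module.End K ((Fin n → ℕ) →₀ K) :=
  Finsupp.linearCombination K fun v =>
    if v i + 1 < D.a i then Finsupp.single (v + Pi.single i 1) (D.coef i v) else 0

theorem op_single (i : Fin n) (v : Fin n → ℕ) (c : K) :
    D.op i (Finsupp.single v c) =
      if v i + 1 < D.a i then Finsupp.single (v + Pi.single i 1) (c * D.coef i v) else 0 := by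
  rw [op, Finsupp.linearCombination_single]
  split_ifs <;> simp

theorem op_pow_single (i : Fin n) (m : ℕ) (v : Fin n → ℕ) (c : K) (h : D.a i ≤ v i + m)
    (hm : 1 ≤ m) : (D.op i ^ m) (Finsupp.single v c) = 0 := by
  induction m generalizing v c with
  | zero => omega
  | succ m ih =>
    rw [pow_succ, Module.End.mul_apply, op_single]
    split_ifs with h1
    · exact ih _ _ (by simp; omega) (by omega)
    · simp

theorem op_comm (i j : Fin n) : D.op j * D.op i = D.q i j • (D.op i * D.op j) := by
  refine Finsupp.lhom_ext fun v c => ?_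
  rw [LinearMap.smul_apply, Module.End.mul_apply, Module.End.mul_apply]
  by_cases hij : i = j
  · subst hij; simp [D.q_self]
  · have hji : j ≠ i := Ne.symm hij
    rw [op_single, op_single]
    by_cases h1 : v i + 1 < D.a i <;> by_cases h2 : v j + 1 < D.a j <;>
      simp only [h1, h2, if_true, if_false, op_single, map_zero, smul_zero, Pi.add_apply,
        Pi.single_eq_of_ne hij, Pi.single_eq_of_ne hji, add_zero, coef_add]
    rw [add_right_comm, Finsupp.smul_single]
    congr 1
    rcases lt_or_gt_of_ne hij with h | h
    · simp only [h, h.not_gt, if_true, if_false, smul_eq_mul]; ring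
    · simp only [h, h.not_gt, if_true, if_false, smul_eq_mul]
      linear_combination (-c * D.coef i v * D.coef j v) * D.q_mul_q i j

/-- The representation of `A(q, a)` used to see that the monomials are independent. -/
noncomputable def rep : D.Alg →ₐ[K] Module.End K ((Fin n → ℕ) →₀ K) :=
  RingQuot.liftAlgHom K ⟨FreeAlgebra.lift K D.op, by
    rintro _ _ (i | ⟨i, j⟩)
    · rw [map_pow, FreeAlgebra.lift_ι_apply, map_zero]
      refine Finsupp.lhom_ext fun v c => ?_
      have := D.two_le_a i
      exact D.op_pow_single i _ v c (by omega) (by omega)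
    · simp only [map_mul, map_smul, FreeAlgebra.lift_ι_apply]
      exact D.op_comm i j⟩

theorem rep_x (i : Fin n) : D.rep (D.x i) = D.op i := by
  unfold rep x proj
  erw [RingQuot.liftAlgHom_mkAlgHom_apply]
  simp

theorem op_pow_of_coef (i : Fin n) (m : ℕ) (w : Fin n → ℕ) (hw : ∀ k ≤ i, w k = 0)
    (hm : m < D.a i) :
    (D.op i ^ m) (Finsupp.single w 1) = Finsupp.single (w + Pi.single i m) 1 := by
  induction m with
  | zero => simp
  | succ m ih =>
    rw [pow_succ', Module.End.mul_apply, ih (by omega), op_single, if_pos (by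
      simp [hw i le_rfl]; omega)]
    have h1 : D.coef i (w + Pi.single i m) = 1 := by
      refine Finset.prod_eq_one fun k hk => ?_
      have hk' := Finset.mem_Iio.1 hk
      simp [hw k hk'.le, hk'.ne]
    rw [h1, one_mul, add_assoc, ← Pi.single_add]

theorem rep_list (v : Fin n → ℕ) (hv : ∀ i, v i < D.a i) (l : List (Fin n))
    (hl : l.Pairwise (· < ·)) :
    D.rep (l.map fun k => D.x k ^ v k).prod (Finsupp.single 0 1) =
      Finsupp.single (fun k => if k ∈ l then v k else 0) 1 := by
  induction l with
  | nil => simp; rfl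
  | cons i l ih =>
    rw [List.pairwise_cons] at hl
    rw [List.map_cons, List.prod_cons, map_mul, Module.End.mul_apply, ih hl.2, map_pow, rep_x,
      op_pow_of_coef _ _ _ _ (fun k hk => if_neg fun hkl => absurd (hl.1 k hkl) hk.not_gt) (hv i)]
    congr 1
    funext k
    by_cases hk : k = i
    · subst hk
      have : k ∉ l := fun h => lt_irrefl _ (hl.1 k h)
      simp [this]
    · simp [hk]

theorem rep_mon (v : D.V) :
    D.rep (D.mon (D.vec v)) (Finsupp.single 0 1) = Finsupp.single (D.vec v) 1 := by
  rw [mon, rep_list _ (D.vec v) (fun i => (v i).2) _ (List.pairwise_lt_finRange n)]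
  simp

theorem linearIndependent_mon : LinearIndependent K fun v : D.V => D.mon (D.vec v) := by
  refine LinearIndependent.of_comp
    ((LinearMap.applyₗ (Finsupp.single (0 : Fin n → ℕ) (1 : K))) ∘ₗ D.rep.toLinearMap) ?_
  have h : (((LinearMap.applyₗ (Finsupp.single (0 : Fin n → ℕ) (1 : K))) ∘ₗ D.rep.toLinearMap) ∘
      fun v : D.V => D.mon (D.vec v)) =
      (fun w : Fin n → ℕ => Finsupp.single w (1 : K)) ∘ D.vec := by
    funext v
    exact D.rep_mon v
  rw [h]
  have hb := (Finsupp.basisSingleOne (R := K) (ι := Fin n → ℕ)).linearIndependent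
  rw [Finsupp.coe_basisSingleOne] at hb
  refine hb.comp _ fun v w hvw => ?_
  funext i
  exact Fin.ext (congrFun hvw i)

/-- The standard basis `{x_v | v ∈ V}` of `A(q, a)`. -/
noncomputable def basis : Module.Basis D.V K D.Alg :=
  Module.Basis.mk D.linearIndependent_mon D.span_mon

theorem basis_apply (v : D.V) : D.basis v = D.mon (D.vec v) := by
  simp [basis]

instance : FiniteDimensional K D.Alg := Module.Finite.of_basis D.basis

/-! #### Structure coefficients, compatible permutations, the explicit structure -/

/-- The linear form `x_{a-1}^*` of the dual basis. -/
noncomputable def topDual : Module.Dual K D.Alg := D.basis.coord D.top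

/-- The structure coefficient `q^{⟨u|v⟩} = ∏_{i<j} q_{ij}^{u_j v_i}`, for `u, v ∈ ℤ^n`. -/
def pairing (u v : Fin n → ℤ) : K := ∏ i, ∏ j ∈ Finset.Ioi i, D.q i j ^ (u j * v i)

/-- `N² = Id` for the canonical Nakayama automorphism `N`, i.e. the Nakayama automorphism with
respect to the Frobenius homomorphism `x_{a-1}^*`. -/
def CanonicalNakayamaSqEqId : Prop :=
  ∃ N : D.Alg ≃ₐ[K] D.Alg, IsNakayamaAutomorphism K D.topDual N ∧ ∀ z, N (N z) = z

/-- Compatible permutations. -/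
def IsCompatible (π : Equiv.Perm (Fin n)) : Prop :=
  (∀ i, D.a (π i) = D.a i) ∧ ∀ i j, D.q (π i) (π j) = D.q j i

/-- `S` is a permutation antipode. -/
def IsPermutationAntipode (B : BiFrobeniusStructure K D.Alg) : Prop :=
  ∃ (σ : Equiv.Perm D.V) (c : D.V → K),
    ∀ v, B.S (D.mon (D.vec v)) = c v • D.mon (D.vec (σ v))

/-- `A(q, a)` admits a bi-Frobenius algebra structure with permutation antipode. -/
def AdmitsPermutationBiFrobenius : Prop :=
  ∃ B : BiFrobeniusStructure K D.Alg, D.IsPermutationAntipode B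

/-- The scalar `∏_i c_i^{v_i} ∏_{j<k} (q^{⟨π(e_k)|π(e_j)⟩})^{v_j v_k}`, where `π(e_i) = e_{π(i)}`. -/
def antipodeCoeff (π : Equiv.Perm (Fin n)) (c : Fin n → K) (v : Fin n → ℕ) : K :=
  (∏ i, c i ^ v i) * ∏ j, ∏ k ∈ Finset.Ioi j,
    D.pairing (Pi.single (π k) 1) (Pi.single (π j) 1) ^ (v j * v k)

/-- The vector `a - 1 - v` of `ℕ^n` (for `v ∈ V` the subtraction is exact). -/
def compl (v : D.V) : Fin n → ℕ := fun i => D.a i - 1 - v i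

/-- The scalar `g_{a-1-v, π(v)}`. -/
def g (π : Equiv.Perm (Fin n)) (c : Fin n → K) (v : D.V) : K :=
  (D.pairing (fun i => (D.compl v i : ℤ)) (fun i => (D.vec v i : ℤ)))⁻¹ *
    D.antipodeCoeff π c (D.vec v)

/-- The action `π(v) = (v_{π⁻¹(1)}, …, v_{π⁻¹(n)})` on vectors. -/
def permVec (π : Equiv.Perm (Fin n)) (v : Fin n → ℕ) : Fin n → ℕ := fun i => v (π⁻¹ i)

/-- The counit `ε(x_v) = δ_{v,0}`. -/
noncomputable def explicitCounit : D.Alg →ₗ[K] K := D.basis.coord D.bot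

/-- The comultiplication with `Δ(1) = 1 ⊗ 1`, with `x_v` primitive for `v ≠ 0, a-1`, and with
`Δ(x_{a-1}) = ∑_{v ∈ V} g_{a-1-v, π(v)} x_{a-1-v} ⊗ x_{π(v)}`. -/
noncomputable def explicitComul (π : Equiv.Perm (Fin n)) (c : Fin n → K) :
    D.Alg →ₗ[K] D.Alg ⊗[K] D.Alg :=
  D.basis.constr K fun v =>
    if v = D.bot then 1 ⊗ₜ[K] 1
    else if v = D.top then
      ∑ w : D.V, D.g π c w • (D.mon (D.compl w) ⊗ₜ[K] D.mon (permVec π (D.vec w)))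
    else 1 ⊗ₜ[K] D.mon (D.vec v) + D.mon (D.vec v) ⊗ₜ[K] 1

/-- The linear map `S(x_v) = ∏_i c_i^{v_i} ∏_{j<k} (q^{⟨π(e_k)|π(e_j)⟩})^{v_j v_k} x_{π(v)}`. -/
noncomputable def explicitAntipode (π : Equiv.Perm (Fin n)) (c : Fin n → K) :
    D.Alg →ₗ[K] D.Alg :=
  D.basis.constr K fun v => D.antipodeCoeff π c (D.vec v) • D.mon (permVec π (D.vec v))

end QCIData

/-! Write ψ for the form x_{a-1}^*. Everything rests on the product rule x_u x_v = q^{⟨u|v⟩} x_{u+v}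
(`mon_mul_mon`): it makes ψ a Frobenius form for which x_{a-1-v} and x_v are dual bases up to the
scalars q^{⟨a-1-v|v⟩}, and the Nakayama automorphism of ψ is diagonal, x_i ↦ h_i x_i with h_i = ∏_k
q_{ki}^{a_k-1}. Thus N² = Id says h_i² = 1, and in characteristic 2 this already forces h_i = 1, so
that ψ is a symmetric form.

Necessity. The counit kills the nilpotent x_i, and t a = ε(a) t, so t lies in the socle, the line
through x_{a-1}; the same holds for S(t). Hence S(t) is a multiple of t, and the coalgebra
anti-homomorphism property gives φ(S²(c) a) = φ(a c), that is, S² is inverse to the Nakayama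
automorphism of φ (`BiFrobeniusStructure.φ_S_S_mul_eq`). An antipode permuting monomials up to
scalars must send x_i to b_i x_{π(i)}, and the defining relations make π compatible. Testing the
identity on c = x_i and a = x_{a-1-e_i} yields π² = 1 and b_i b_{π(i)} h_i = 1, so h_{π(i)} = h_i;
compatibility gives h_{π(i)} h_i = 1, and therefore h_i = 1.

Sufficiency. A compatible involution π defines an involutive anti-automorphism S with x_i ↦
x_{π(i)}. The element Δ(x_{a-1}) is (id ⊗ S) applied to the dual-basis tensor of ψ, which makes S(a)
= ∑ φ(t₁a)t₂ the dual-basis expansion of a. Coassociativity holds because all other nonconstant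
monomials are primitive; S reverses Δ because S² = 1, S(x_{a-1}) = x_{a-1} and ψ is symmetric. -/

namespace QCIData

variable {K : Type*} [Field K] {n : ℕ} (D : QCIData K n)

/-! ### Products of monomials -/

theorem q_ne_zero (i j : Fin n) : D.q i j ≠ 0 :=
  left_ne_zero_of_mul_eq_one (D.q_mul_q i j)

theorem coef_ne_zero (i : Fin n) (v : Fin n → ℕ) : D.coef i v ≠ 0 :=
  Finset.prod_ne_zero_iff.2 fun _ _ => pow_ne_zero _ (D.q_ne_zero _ _)

theorem coef_add_vec (i : Fin n) (u v : Fin n → ℕ) :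
    D.coef i (u + v) = D.coef i u * D.coef i v := by
  simp [coef, pow_add, Finset.prod_mul_distrib]

theorem mon_zero : D.mon 0 = 1 := by simp [mon]

/-- Moving x_i into place in an increasing product crosses only the variables with smaller index,
which gives the scalar exactly. The test `k ∈ l` lets the induction run over tails of the full list.
-/
theorem x_mul_sorted_list (i : Fin n) (v : Fin n → ℕ) (l : List (Fin n))
    (hl : l.Pairwise (· < ·)) (hi : i ∈ l) :
    D.x i * (l.map fun k => D.x k ^ v k).prod =
      (∏ k ∈ Finset.Iio i, if k ∈ l then D.q k i ^ v k else 1) •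
        (l.map fun k => D.x k ^ (v + Pi.single i 1 : Fin n → ℕ) k).prod := by
  induction l with
  | nil => simp at hi
  | cons k l ih =>
    rw [List.pairwise_cons] at hl
    by_cases hk : i = k
    · subst hk
      have h0 : (∏ k ∈ Finset.Iio i, if k ∈ i :: l then D.q k i ^ v k else 1) = 1 := by
        refine Finset.prod_eq_one fun k hk => if_neg fun h => ?_
        have hk := Finset.mem_Iio.1 hk
        rcases List.mem_cons.1 h with h | h
        · exact hk.ne h
        · exact hk.not_gt (hl.1 k h)
      have : (l.map fun k => D.x k ^ (v + Pi.single i 1 : Fin n → ℕ) k) =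
          l.map fun k => D.x k ^ v k := by
        refine List.map_congr_left fun j hj => ?_
        have : j ≠ i := (hl.1 j hj).ne'
        simp [this]
      rw [h0, List.map_cons, List.map_cons, List.prod_cons, List.prod_cons, this, one_smul,
        ← mul_assoc]
      simp [pow_succ']
    · have hil : i ∈ l := by simpa [hk] using hi
      have hki : k < i := hl.1 i hil
      have hkl : k ∉ l := fun h => lt_irrefl _ (hl.1 k h)
      have h0 : (∏ j ∈ Finset.Iio i, if j ∈ k :: l then D.q j i ^ v j else 1) =
          D.q k i ^ v k * ∏ j ∈ Finset.Iio i, if j ∈ l then D.q j i ^ v j else 1 := by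
        have : ∀ j, (if j ∈ k :: l then D.q j i ^ v j else 1) =
            (if j = k then D.q k i ^ v k else 1) * if j ∈ l then D.q j i ^ v j else 1 := by
          intro j
          by_cases hj : j = k
          · subst hj; simp [hkl]
          · simp [hj]
        simp only [this, Finset.prod_mul_distrib, Finset.prod_ite_eq', Finset.mem_Iio, hki, if_true]
      rw [h0, List.map_cons, List.map_cons, List.prod_cons, List.prod_cons, ← mul_assoc, x_mul_pow,
        smul_mul_assoc, mul_assoc, ih hl.2 hil, mul_smul_comm, smul_smul]
      simp [Ne.symm hk]

theorem x_mul_mon_eq (i : Fin n) (v : Fin n → ℕ) :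
    D.x i * D.mon v = D.coef i v • D.mon (v + Pi.single i 1) := by
  have := D.x_mul_sorted_list i v _ (List.pairwise_lt_finRange n) (List.mem_finRange i)
  simpa [mon, coef] using this

theorem mon_single (i : Fin n) : D.mon (Pi.single i 1) = D.x i := by
  have := D.x_mul_mon_eq i 0
  simpa [mon_zero, coef] using this.symm

/-- Induction on the total degree. -/
theorem exponent_induction {p : (Fin n → ℕ) → Prop} (h0 : p 0)
    (h1 : ∀ i v, p v → p (v + Pi.single i 1)) (v : Fin n → ℕ) : p v := by
  obtain ⟨m, hm⟩ : ∃ m, ∑ i, v i = m := ⟨_, rfl⟩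
  induction m generalizing v with
  | zero =>
    have : v = 0 := by
      funext i
      exact (Finset.sum_eq_zero_iff.1 hm) i (Finset.mem_univ i)
    rwa [this]
  | succ m ih =>
    obtain ⟨i, -, hi⟩ : ∃ i ∈ Finset.univ, v i ≠ 0 :=
      Finset.exists_ne_zero_of_sum_ne_zero (by omega)
    have hv : v = (v - Pi.single i 1) + Pi.single i 1 := by
      funext k
      by_cases hk : k = i
      · subst hk; simp; omega
      · simp [hk]
    rw [hv]
    refine h1 _ _ (ih _ ?_)
    rw [hv] at hm
    simp only [Pi.add_apply, Finset.sum_add_distrib, Finset.sum_pi_single', Finset.mem_univ,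
      if_true] at hm
    omega

/-- The scalar `q^{⟨u|v⟩}` for exponents `u, v ∈ ℕ^n`. -/
def natPairing (u v : Fin n → ℕ) : K := D.pairing (fun i => (u i : ℤ)) (fun i => (v i : ℤ))

theorem natPairing_ne_zero (u v : Fin n → ℕ) : D.natPairing u v ≠ 0 := by
  unfold natPairing pairing
  exact Finset.prod_ne_zero_iff.2 fun _ _ => Finset.prod_ne_zero_iff.2 fun _ _ =>
    zpow_ne_zero _ (D.q_ne_zero _ _)

theorem natPairing_eq (u v : Fin n → ℕ) :
    D.natPairing u v = ∏ i, ∏ j ∈ Finset.Ioi i, D.q i j ^ (u j * v i) := by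
  unfold natPairing pairing
  refine Finset.prod_congr rfl fun i _ => Finset.prod_congr rfl fun j _ => ?_
  rw [← zpow_natCast]
  push_cast
  rfl

theorem natPairing_add_single (u v : Fin n → ℕ) (i : Fin n) :
    D.natPairing (u + Pi.single i 1) v = D.natPairing u v * D.coef i v := by
  rw [natPairing_eq, natPairing_eq]
  have : ∀ k j, D.q k j ^ ((u + Pi.single i 1 : Fin n → ℕ) j * v k) =
      D.q k j ^ (u j * v k) * if j = i then D.q k i ^ v k else 1 := by
    intro k j
    by_cases h : j = i
    · subst h; simp [add_mul, pow_add]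
    · simp [h]
  simp only [this, Finset.prod_mul_distrib, Finset.prod_ite_eq', Finset.mem_Ioi]
  rw [← Finset.prod_filter]
  unfold coef
  congr 2
  ext; simp

theorem natPairing_zero_left (v : Fin n → ℕ) : D.natPairing 0 v = 1 := by
  simp [natPairing_eq]

theorem natPairing_zero_right (v : Fin n → ℕ) : D.natPairing v 0 = 1 := by
  simp [natPairing_eq]

theorem natPairing_single_right (v : Fin n → ℕ) (i : Fin n) :
    D.natPairing v (Pi.single i 1) = ∏ k ∈ Finset.Ioi i, D.q i k ^ v k := by
  rw [natPairing_eq]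
  rw [Finset.prod_eq_single i]
  · simp
  · intro j _ hj
    simp [hj]
  · simp

/-- Induction on u: multiplying by x_i on the left contributes `coef i u` on one side and `coef i (u
+ v)` on the other, and their quotient `coef i v` is the increment of the pairing. No bound on u and
v is needed, since monomials with too large an exponent vanish. -/
theorem mon_mul_mon (u v : Fin n → ℕ) :
    D.mon u * D.mon v = D.natPairing u v • D.mon (u + v) := by
  induction u using exponent_induction with
  | h0 => simp [mon_zero, natPairing_zero_left]
  | h1 i u ih =>
    have h := congrArg (D.x i * ·) ih
    simp only [mul_smul_comm] at h
    rw [← mul_assoc, x_mul_mon_eq, x_mul_mon_eq, coef_add_vec, smul_mul_assoc, smul_smul] at h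
    have h2 := congrArg ((D.coef i u)⁻¹ • ·) h
    simp only [smul_smul, inv_mul_cancel₀ (D.coef_ne_zero i u), one_smul] at h2
    rw [h2, natPairing_add_single, add_right_comm]
    congr 1
    have := D.coef_ne_zero i u
    field_simp

theorem mon_mul_x (v : Fin n → ℕ) (i : Fin n) :
    D.mon v * D.x i = D.natPairing v (Pi.single i 1) • D.mon (v + Pi.single i 1) := by
  rw [← mon_single, mon_mul_mon]

theorem alg_induction {p : D.Alg → Prop} (hc : ∀ r, p (algebraMap K _ r)) (hx : ∀ i, p (D.x i))
    (hm : ∀ a b, p a → p b → p (a * b)) (ha : ∀ a b, p a → p b → p (a + b)) (z : D.Alg) : p z := by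
  obtain ⟨w, rfl⟩ := RingQuot.mkAlgHom_surjective K D.Rel z
  induction w using FreeAlgebra.induction with
  | grade0 r => rw [AlgHom.commutes]; exact hc r
  | grade1 i => exact hx i
  | mul a b iha ihb => rw [map_mul]; exact hm _ _ iha ihb
  | add a b iha ihb => rw [map_add]; exact ha _ _ iha ihb

/-! ### Indices in V and the Frobenius form x_{a-1}^* -/

/-- The element of `V` with a given underlying vector. -/
def toV (v : Fin n → ℕ) (h : ∀ i, v i < D.a i) : D.V := fun i => ⟨v i, h i⟩

theorem vec_injective : Function.Injective D.vec := fun _ _ h =>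
  funext fun i => Fin.ext (congrFun h i)

theorem vec_bot : D.vec D.bot = 0 := rfl

theorem vec_toV (v : Fin n → ℕ) (h : ∀ i, v i < D.a i) : D.vec (D.toV v h) = v := rfl

theorem vec_top_apply (i : Fin n) : D.vec D.top i = D.a i - 1 := rfl

theorem topDual_mon_vec (v : D.V) : D.topDual (D.mon (D.vec v)) = if v = D.top then 1 else 0 := by
  rw [← basis_apply, topDual, Module.Basis.coord_apply, Module.Basis.repr_self,
    Finsupp.single_apply]

theorem topDual_mon (v : Fin n → ℕ) :
    D.topDual (D.mon v) = if v = D.vec D.top then 1 else 0 := by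
  by_cases h : ∃ i, D.a i ≤ v i
  · obtain ⟨i, hi⟩ := h
    rw [D.mon_eq_zero v i hi, map_zero, if_neg]
    rintro rfl
    have := D.two_le_a i
    rw [vec_top_apply] at hi
    omega
  · push Not at h
    rw [← D.vec_toV v h, topDual_mon_vec]
    simp only [D.vec_injective.eq_iff]

theorem mon_vec_ne_zero (v : D.V) : D.mon (D.vec v) ≠ 0 := by
  rw [← basis_apply]; exact D.basis.ne_zero v

theorem x_ne_zero (i : Fin n) : D.x i ≠ 0 := by
  have h : ∀ k, (Pi.single i 1 : Fin n → ℕ) k < D.a k := fun k => by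
    have := D.two_le_a k
    by_cases hk : k = i
    · subst hk; simp; omega
    · simp [hk]; omega
  rw [← mon_single, ← D.vec_toV _ h]
  exact D.mon_vec_ne_zero _

/-- The complement `a - 1 - v`, as an involution of `V`. -/
def complEquiv : Equiv.Perm D.V := Function.Involutive.toPerm (fun v i => (v i).rev)
  fun v => funext fun i => Fin.rev_rev (v i)

theorem vec_complEquiv (v : D.V) : D.vec (D.complEquiv v) = D.compl v := by
  funext i
  change ((v i).rev : ℕ) = D.a i - 1 - v i
  rw [Fin.val_rev]
  omega

theorem complEquiv_complEquiv (v : D.V) : D.complEquiv (D.complEquiv v) = v :=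
  funext fun i => Fin.rev_rev (v i)

theorem compl_add_vec (v w : D.V) : D.compl v + D.vec w = D.vec D.top ↔ v = w := by
  constructor
  · intro h
    funext i
    have := congrFun h i
    simp only [Pi.add_apply, compl, vec, top] at this
    have h1 := (v i).2
    exact Fin.ext (by omega)
  · rintro rfl
    funext i
    have h1 := (v i).2
    simp only [Pi.add_apply, compl, vec, top]
    omega

theorem vec_add_compl (v w : D.V) : D.vec w + D.compl v = D.vec D.top ↔ v = w := by
  rw [add_comm, compl_add_vec]

theorem topDual_compl_mul (v w : D.V) : D.topDual (D.mon (D.compl v) * D.mon (D.vec w)) =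
    if v = w then D.natPairing (D.compl v) (D.vec v) else 0 := by
  rw [mon_mul_mon, map_smul, topDual_mon]
  simp only [compl_add_vec]
  split_ifs with h
  · subst h; simp
  · simp

/-- The element `z = ∑_v ψ(x_{a-1-v} z) q^{-⟨a-1-v|v⟩} x_v`, where `ψ = x_{a-1}^*`. -/
theorem sum_topDual_compl_mul (z : D.Alg) :
    ∑ v : D.V, (D.topDual (D.mon (D.compl v) * z) * (D.natPairing (D.compl v) (D.vec v))⁻¹) •
      D.mon (D.vec v) = z := by
  induction D.span_mon (Submodule.mem_top (x := z)) using Submodule.span_induction with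
  | mem z hz =>
    obtain ⟨w, rfl⟩ := hz
    simp only [topDual_compl_mul]
    rw [Finset.sum_eq_single w]
    · simp [natPairing_ne_zero]
    · intro v _ hv
      simp [hv]
    · simp
  | zero => simp
  | add y z _ _ hy hz => simp only [mul_add, map_add, add_mul, add_smul, Finset.sum_add_distrib, hy, hz]
  | smul c z _ hz =>
    conv_rhs => rw [← hz]
    simp only [mul_smul_comm, map_smul, smul_eq_mul, mul_assoc, mul_smul, Finset.smul_sum]

theorem eq_zero_of_topDual_mul_left {z : D.Alg} (h : ∀ y, D.topDual (y * z) = 0) : z = 0 := by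
  rw [← D.sum_topDual_compl_mul z]
  simp [h]

/-- The linear map sending `z` to the linear form `y ↦ ψ(yz)`, where `ψ = x_{a-1}^*`. -/
noncomputable def topDualMul : D.Alg →ₗ[K] Module.Dual K D.Alg :=
  (LinearMap.mul K D.Alg).flip.compr₂ D.topDual

theorem topDualMul_apply (z y : D.Alg) : D.topDualMul z y = D.topDual (y * z) := rfl

/-- Injective by the dual-basis expansion, hence bijective because A and its dual have the same
dimension. -/
theorem topDualMul_bijective : Function.Bijective D.topDualMul := by
  have hi : Function.Injective D.topDualMul := by
    rw [injective_iff_map_eq_zero]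
    intro z hz
    exact D.eq_zero_of_topDual_mul_left fun y => by rw [← topDualMul_apply, hz]; rfl
  refine ⟨hi, ?_⟩
  exact (LinearMap.injective_iff_surjective_of_finrank_eq_finrank
    Subspace.dual_finrank_eq.symm).1 hi

theorem isFrobeniusHom_topDual : IsFrobeniusHom K D.topDual := fun f => by
  obtain ⟨z, rfl⟩ := D.topDualMul_bijective.2 f
  exact ⟨z, fun _ => rfl⟩

/-- A Frobenius homomorphism is nondegenerate in the first variable. -/
theorem _root_.IsFrobeniusHom.eq_zero {A : Type*} [Ring A] [Algebra K A] {φ : Module.Dual K A}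
    (hφ : IsFrobeniusHom K φ) {z : A} (h : ∀ y, φ (z * y) = 0) : z = 0 := by
  rw [← Module.forall_dual_apply_eq_zero_iff K]
  intro f
  obtain ⟨y, hy⟩ := hφ f
  rw [hy, h]

/-! #### The canonical Nakayama automorphism -/

/-- The scalar `h_i` with `x_{a-1}^*(x_i y) = h_i x_{a-1}^*(y x_i)`. -/
def nakayamaScalar (i : Fin n) : K := ∏ k, D.q k i ^ (D.a k - 1)

theorem x_mul_list_comm (i : Fin n) (v : Fin n → ℕ) (l : List (Fin n)) :
    D.x i * (l.map fun k => D.x k ^ v k).prod =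
      (l.map fun k => D.q k i ^ v k).prod • ((l.map fun k => D.x k ^ v k).prod * D.x i) := by
  induction l with
  | nil => simp
  | cons k l ih =>
    rw [List.map_cons, List.prod_cons, List.map_cons, List.prod_cons, ← mul_assoc, x_mul_pow,
      smul_mul_assoc, mul_assoc, ih, mul_smul_comm, smul_smul, mul_assoc]

theorem x_mul_mon_comm (i : Fin n) (v : Fin n → ℕ) :
    D.x i * D.mon v = (∏ k, D.q k i ^ v k) • (D.mon v * D.x i) := by
  rw [mon, x_mul_list_comm]
  congr 1

/-- The exponents agree with a-1 except at i, where q_{ii} = 1 makes the exponent irrelevant. -/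
theorem prod_q_pow_of_add_single (i : Fin n) (v : Fin n → ℕ)
    (h : v + Pi.single i 1 = D.vec D.top) : ∏ k, D.q k i ^ v k = D.nakayamaScalar i := by
  refine Finset.prod_congr rfl fun k _ => ?_
  by_cases hk : k = i
  · subst hk; simp [D.q_self]
  · have := congrFun h k
    simp only [Pi.add_apply, Pi.single_eq_of_ne hk, add_zero, vec_top_apply] at this
    rw [this]

/-- On a monomial x_w both sides vanish unless w + e_i = a-1, and then commuting x_i past x_w
produces h_i. -/
theorem topDual_x_mul (i : Fin n) (y : D.Alg) :
    D.topDual (D.x i * y) = D.nakayamaScalar i * D.topDual (y * D.x i) := by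
  induction D.span_mon (Submodule.mem_top (x := y)) using Submodule.span_induction with
  | mem z hz =>
    obtain ⟨w, rfl⟩ := hz
    by_cases h : D.vec w + Pi.single i 1 = D.vec D.top
    · rw [x_mul_mon_comm, D.prod_q_pow_of_add_single i _ h, map_smul, smul_eq_mul]
    · rw [x_mul_mon_eq, mon_mul_x, map_smul, map_smul, topDual_mon, if_neg h]
      simp
  | zero => simp
  | add y z _ _ hy hz => simp only [mul_add, add_mul, map_add, hy, hz]
  | smul c z _ hz => simp only [mul_smul_comm, smul_mul_assoc, map_smul, hz, smul_eq_mul]; ring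

/-- Commuting with every y under ψ is stable under products: ψ(aby) = ψ(bya) = ψ(yab). So the
generators suffice. -/
theorem topDual_mul_comm (h : ∀ i, D.nakayamaScalar i = 1) (x y : D.Alg) :
    D.topDual (x * y) = D.topDual (y * x) := by
  induction x using D.alg_induction generalizing y with
  | hc r => rw [Algebra.commutes]
  | hx i => rw [topDual_x_mul, h, one_mul]
  | hm a b ha hb => rw [mul_assoc, ha, mul_assoc, hb, mul_assoc]
  | ha a b ha hb => rw [add_mul, mul_add, map_add, map_add, ha, hb]

theorem isBimoduleSymmetric (h : ∀ i, D.nakayamaScalar i = 1) : IsBimoduleSymmetric K D.Alg := by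
  refine ⟨LinearEquiv.ofBijective _ D.topDualMul_bijective, fun a b x y => ?_⟩
  simp only [LinearEquiv.ofBijective_apply, topDualMul_apply]
  rw [← mul_assoc, D.topDual_mul_comm h _ b]
  simp only [mul_assoc]

theorem canonicalNakayamaSqEqId (h : ∀ i, D.nakayamaScalar i = 1) : D.CanonicalNakayamaSqEqId :=
  ⟨AlgEquiv.refl, fun x y => D.topDual_mul_comm h x y, fun _ => rfl⟩

/-- Nondegeneracy of ψ forces N(x_i) = h_i x_i, and applying N twice gives h_i². -/
theorem nakayamaScalar_sq (h : D.CanonicalNakayamaSqEqId) (i : Fin n) :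
    D.nakayamaScalar i ^ 2 = 1 := by
  obtain ⟨N, hN, hN2⟩ := h
  have h1 : N (D.x i) = D.nakayamaScalar i • D.x i := by
    rw [← sub_eq_zero]
    refine D.eq_zero_of_topDual_mul_left fun y => ?_
    rw [mul_sub, map_sub, ← hN, topDual_x_mul, mul_smul_comm, map_smul, smul_eq_mul, sub_self]
  have h2 := hN2 (D.x i)
  rw [h1, map_smul, h1, smul_smul] at h2
  have h3 : (D.nakayamaScalar i * D.nakayamaScalar i - 1) • D.x i = 0 := by
    rw [sub_smul, h2, one_smul, sub_self]
  rw [sq]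
  exact sub_eq_zero.1 ((smul_eq_zero.1 h3).resolve_right (D.x_ne_zero i))

/-- In characteristic 2, c² - 1 = (c - 1)². -/
theorem eq_one_of_sq_eq_one [CharP K 2] {c : K} (h : c ^ 2 = 1) : c = 1 := by
  have : (c - 1) ^ 2 = 0 := by
    have h2 : (2 : K) = 0 := CharTwo.two_eq_zero
    linear_combination h - (c - 1) * h2
  exact sub_eq_zero.1 (pow_eq_zero_iff two_ne_zero |>.1 this)

end QCIData

/-! ### Identities in a general bi-Frobenius algebra -/

section Frobenius

variable {K : Type*} {A : Type*} [Field K] [Ring A] [Algebra K A]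

@[simp] theorem tensorContract_tmul (f : Module.Dual K A) (a b : A) :
    tensorContract K f (a ⊗ₜ[K] b) = f a • b := by
  simp [tensorContract]

@[simp] theorem tensorContract_add (f : Module.Dual K A) (v w : A ⊗[K] A) :
    tensorContract K f (v + w) = tensorContract K f v + tensorContract K f w := by
  simp [tensorContract]

@[simp] theorem tensorContract_smul (f : Module.Dual K A) (c : K) (w : A ⊗[K] A) :
    tensorContract K f (c • w) = c • tensorContract K f w := by
  simp [tensorContract]

@[simp] theorem tensorContract_sum {ι : Type*} (s : Finset ι) (f : Module.Dual K A)
    (w : ι → A ⊗[K] A) :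
    tensorContract K f (∑ i ∈ s, w i) = ∑ i ∈ s, tensorContract K f (w i) := by
  simp [tensorContract]

namespace BiFrobeniusStructure

variable [FiniteDimensional K A] (B : BiFrobeniusStructure K A)

theorem counit_tensorContract (f : Module.Dual K A) (a : A) :
    B.counit (tensorContract K f (B.comul a)) = f a := by
  have h1 : ∀ w : A ⊗[K] A, B.counit (tensorContract K f w) =
      f (TensorProduct.rid K A (LinearMap.lTensor A B.counit w)) := by
    intro w
    induction w with
    | zero => simp [tensorContract]
    | tmul a b => simp [mul_comm]
    | add v w hv hw => simp only [tensorContract_add, map_add, hv, hw]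
  rw [h1]
  have := B.lTensor_counit_comp_comul
  have := LinearMap.congr_fun this a
  simp only [LinearMap.comp_apply] at this
  rw [this]
  simp

/-- Apply ε to S(a) = ∑ φ(t₁a)t₂ and use ε ∘ S = ε with the counit axiom. -/
theorem counit_eq_φ_t_mul (a : A) : B.counit a = B.φ (B.t * a) := by
  rw [← B.counit_S, B.S_eq, counit_tensorContract]
  rfl

theorem φ_t : B.φ B.t = 1 := by
  rw [← B.counit_one, counit_eq_φ_t_mul, mul_one]

/-- Both sides pair with every y to ε(a)ε(y) under φ, which is nondegenerate. -/
theorem t_mul (a : A) : B.t * a = B.counit a • B.t := by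
  rw [← sub_eq_zero]
  refine B.frobenius.eq_zero fun y => ?_
  rw [sub_mul, map_sub, mul_assoc, ← counit_eq_φ_t_mul, B.counit_mul, smul_mul_assoc, map_smul,
    ← counit_eq_φ_t_mul, smul_eq_mul, sub_self]

/-- Every linear form is φ(- z), and contracting Δ(t) with it gives S(z); by the Frobenius coalgebra
condition these contractions exhaust A. -/
theorem S_surjective : Function.Surjective B.S := by
  intro a
  obtain ⟨f, hf⟩ := B.cofrobenius a
  obtain ⟨z, hz⟩ := B.frobenius f
  refine ⟨z, ?_⟩
  rw [B.S_eq, ← hf]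
  congr 1
  ext x
  exact (hz x).symm

theorem S_injective : Function.Injective B.S :=
  LinearMap.injective_iff_surjective.2 B.S_surjective

theorem mul_S_t (a : A) : a * B.S B.t = B.counit a • B.S B.t := by
  obtain ⟨b, rfl⟩ := B.S_surjective a
  rw [← B.S_mul, t_mul, map_smul, B.counit_S]

/-- If `S(t) = d t`, then `S²` is up to the scalar `d` inverse to the Nakayama automorphism. -/
theorem φ_S_S_mul {d : K} (hd : B.S B.t = d • B.t) (a c : A) :
    B.φ (B.S (B.S c) * a) = d * B.φ (a * c) := by
  -- The map x ⊗ y ↦ φ(S(y)a) x. Its value at Δ(t) is computed twice, through S(t) and through S(c).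
  let M : A ⊗[K] A →ₗ[K] A := (TensorProduct.rid K A).toLinearMap ∘ₗ
    LinearMap.lTensor A (B.φ ∘ₗ LinearMap.mulRight K a ∘ₗ B.S)
  have h1 : ∀ w : A ⊗[K] A, tensorContract K (B.φ ∘ₗ LinearMap.mulRight K a)
      (TensorProduct.map B.S B.S (TensorProduct.comm K A A w)) = B.S (M w) := by
    intro w
    induction w with
    | zero => simp [tensorContract]
    | tmul x y => simp [M]
    | add v w hv hw => simp only [tensorContract_add, map_add, hv, hw]
  have h2 : ∀ w : A ⊗[K] A, B.φ (M w * c) =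
      B.φ (B.S (tensorContract K (B.φ ∘ₗ LinearMap.mulRight K c) w) * a) := by
    intro w
    induction w with
    | zero => simp [tensorContract]
    | tmul x y => simp [M, mul_comm]
    | add v w hv hw => simp only [tensorContract_add, map_add, add_mul, hv, hw]
  -- S(M(Δt)) is Δ(S(t)) contracted with φ(- a); as S(t) = d t, this is d S(a), and S is injective.
  have h3 : M (B.comul B.t) = d • a := by
    apply B.S_injective
    rw [← h1, ← B.comul_S, hd, map_smul, tensorContract_smul, ← B.S_eq, map_smul]
  rw [B.S_eq c, ← h2, h3, smul_mul_assoc, map_smul, smul_eq_mul]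

/-- Taking a = t and c = 1 in the previous identity gives d = 1, because φ(t) = 1. -/
theorem φ_S_S_mul_eq {d : K} (hd : B.S B.t = d • B.t) (a c : A) :
    B.φ (B.S (B.S c) * a) = B.φ (a * c) := by
  have h := B.φ_S_S_mul hd B.t 1
  rw [B.S_one, B.S_one, mul_one, one_mul, φ_t, mul_one] at h
  rw [B.φ_S_S_mul hd, ← h, one_mul]

end BiFrobeniusStructure

end Frobenius

namespace QCIData

variable {K : Type*} [Field K] {n : ℕ} (D : QCIData K n)

/-! ### The socle -/

theorem topDual_top_mul_mon (v : Fin n → ℕ) :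
    D.topDual (D.mon (D.vec D.top) * D.mon v) = if v = 0 then 1 else 0 := by
  rw [mon_mul_mon, map_smul, topDual_mon]
  by_cases h : v = 0
  · subst h; simp [natPairing_zero_right]
  · rw [if_neg, if_neg h, smul_zero]
    intro h1
    exact h (by simpa using h1)

theorem topDual_mon_mul_top (v : Fin n → ℕ) :
    D.topDual (D.mon v * D.mon (D.vec D.top)) = if v = 0 then 1 else 0 := by
  rw [mon_mul_mon, map_smul, topDual_mon]
  by_cases h : v = 0
  · subst h; simp [natPairing_zero_left]
  · rw [if_neg, if_neg h, smul_zero]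
    intro h1
    exact h (by simpa using h1)

theorem topDual_top : D.topDual (D.mon (D.vec D.top)) = 1 := by
  rw [topDual_mon, if_pos rfl]

/-- The socle of `A(q, a)` is spanned by `x_{a-1}`. -/
theorem eq_smul_top {z : D.Alg} (h : ∀ i, D.x i * z = 0) :
    z = D.topDual z • D.mon (D.vec D.top) := by
  -- For v_i > 0, x_v is a nonzero multiple of x_{v-e_i} x_i, hence kills z.
  have h1 : ∀ v : Fin n → ℕ, v ≠ 0 → D.mon v * z = 0 := by
    intro v hv
    obtain ⟨i, hi⟩ := Function.ne_iff.1 hv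
    have hv : v = (v - Pi.single i 1) + Pi.single i 1 := by
      funext k
      by_cases hk : k = i
      · subst hk; simp at hi ⊢; omega
      · simp [hk]
    have h2 := D.mon_mul_x (v - Pi.single i 1) i
    rw [← hv] at h2
    have h3 := congrArg (· * z) h2
    simp only [mul_assoc, h i, mul_zero, smul_mul_assoc] at h3
    exact (smul_eq_zero.1 h3.symm).resolve_left (D.natPairing_ne_zero _ _)
  rw [← sub_eq_zero]
  refine D.eq_zero_of_topDual_mul_left fun y => ?_
  induction D.span_mon (Submodule.mem_top (x := y)) using Submodule.span_induction with
  | mem y hy =>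
    obtain ⟨w, rfl⟩ := hy
    rw [mul_sub, map_sub, mul_smul_comm, map_smul, topDual_mon_mul_top]
    by_cases hw : D.vec w = 0
    · simp [hw, mon_zero]
    · simp [hw, h1]
  | zero => simp
  | add y y' _ _ hy hy' => rw [add_mul, map_add, hy, hy', add_zero]
  | smul c y _ hy => rw [smul_mul_assoc, map_smul, hy, smul_zero]

theorem eq_smul_top' {z : D.Alg} (h : ∀ i, z * D.x i = 0) :
    z = D.topDual z • D.mon (D.vec D.top) := by
  have h1 : ∀ v : Fin n → ℕ, v ≠ 0 → z * D.mon v = 0 := by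
    intro v hv
    obtain ⟨i, hi⟩ := Function.ne_iff.1 hv
    have hv : v = (v - Pi.single i 1) + Pi.single i 1 := by
      funext k
      by_cases hk : k = i
      · subst hk; simp at hi ⊢; omega
      · simp [hk]
    have h2 := D.x_mul_mon_eq i (v - Pi.single i 1)
    rw [← hv] at h2
    have h3 := congrArg (z * ·) h2
    simp only [← mul_assoc, h i, zero_mul, mul_smul_comm] at h3
    exact (smul_eq_zero.1 h3.symm).resolve_left (D.coef_ne_zero _ _)
  rw [← sub_eq_zero]
  refine D.isFrobeniusHom_topDual.eq_zero fun y => ?_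
  induction D.span_mon (Submodule.mem_top (x := y)) using Submodule.span_induction with
  | mem y hy =>
    obtain ⟨w, rfl⟩ := hy
    rw [sub_mul, map_sub, smul_mul_assoc, map_smul, topDual_top_mul_mon]
    by_cases hw : D.vec w = 0
    · simp [hw, mon_zero]
    · simp [hw, h1]
  | zero => simp
  | add y y' _ _ hy hy' => rw [mul_add, map_add, hy, hy', add_zero]
  | smul c y _ hy => rw [mul_smul_comm, map_smul, hy, smul_zero]

/-! #### Necessity of the conditions -/

section Necessity

variable (B : BiFrobeniusStructure K D.Alg)

/-- A multiplicative map to a field kills nilpotent elements. -/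
theorem counit_x (i : Fin n) : B.counit (D.x i) = 0 := by
  have h : ∀ m, B.counit (D.x i ^ m) = B.counit (D.x i) ^ m := by
    intro m
    induction m with
    | zero => rw [pow_zero, pow_zero, B.counit_one]
    | succ m ih => rw [pow_succ, B.counit_mul, ih, pow_succ]
  have h1 := h (D.a i)
  rw [x_pow, map_zero] at h1
  exact eq_zero_of_pow_eq_zero h1.symm

theorem t_eq_smul_top : B.t = D.topDual B.t • D.mon (D.vec D.top) :=
  D.eq_smul_top' fun i => by rw [B.t_mul, counit_x, zero_smul]

theorem S_t_eq_smul_top : B.S B.t = D.topDual (B.S B.t) • D.mon (D.vec D.top) :=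
  D.eq_smul_top fun i => by rw [B.mul_S_t, counit_x, zero_smul]

theorem topDual_t_mul_φ_top : D.topDual B.t * B.φ (D.mon (D.vec D.top)) = 1 := by
  rw [← B.φ_t, ← smul_eq_mul, ← map_smul, ← t_eq_smul_top]

/-- Both t and S(t) lie on the socle line and t ≠ 0, so S(t) is a multiple of t. -/
theorem φ_S_S_mul_eq (a c : D.Alg) : B.φ (B.S (B.S c) * a) = B.φ (a * c) := by
  have h0 : D.topDual B.t ≠ 0 := left_ne_zero_of_mul_eq_one (D.topDual_t_mul_φ_top B)
  refine B.φ_S_S_mul_eq (d := D.topDual (B.S B.t) * (D.topDual B.t)⁻¹) ?_ a c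
  have h1 : D.mon (D.vec D.top) = (D.topDual B.t)⁻¹ • B.t := by
    conv_rhs => rw [t_eq_smul_top, map_smul, topDual_top, smul_eq_mul, mul_one]
    rw [smul_smul, inv_mul_cancel₀ h0, one_smul]
  conv_lhs => rw [S_t_eq_smul_top, h1, smul_smul]

end Necessity

/-! ### Antipodes that permute the monomials -/

theorem single_lt (i k : Fin n) : (Pi.single i 1 : Fin n → ℕ) k < D.a k := by
  have := D.two_le_a k
  by_cases hk : k = i
  · subst hk; simp; omega
  · simp [hk]; omega

/-- The unit vector `e_i` as an element of `V`. -/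
def unitV (i : Fin n) : D.V := D.toV (Pi.single i 1) (D.single_lt i)

theorem vec_unitV (i : Fin n) : D.vec (D.unitV i) = Pi.single i 1 := rfl

theorem mon_unitV (i : Fin n) : D.mon (D.vec (D.unitV i)) = D.x i := by
  rw [vec_unitV, mon_single]

theorem unitV_injective : Function.Injective D.unitV := by
  intro i j h
  have h1 := congrFun (congrArg D.vec h) i
  rw [vec_unitV, vec_unitV, Pi.single_eq_same] at h1
  by_contra hij
  rw [Pi.single_eq_of_ne hij] at h1
  exact one_ne_zero h1

theorem unitV_ne_bot (i : Fin n) : D.unitV i ≠ D.bot := by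
  intro h
  have h1 := congrFun (congrArg D.vec h) i
  rw [vec_unitV, vec_bot, Pi.single_eq_same] at h1
  exact one_ne_zero h1

theorem vec_eq_of_smul_mon_eq {u : Fin n → ℕ} {v : D.V} {b c : K} (hc : c ≠ 0)
    (h : b • D.mon u = c • D.mon (D.vec v)) : u = D.vec v := by
  have hne : c • D.mon (D.vec v) ≠ 0 := smul_ne_zero hc (D.mon_vec_ne_zero v)
  have h1 : ∀ i, u i < D.a i := by
    by_contra! h2
    obtain ⟨i, hi⟩ := h2
    rw [D.mon_eq_zero u i hi, smul_zero] at h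
    exact hne h.symm
  rw [← D.vec_toV u h1, ← basis_apply, ← basis_apply] at h
  have h2 := congrArg (fun z => D.basis.repr z v) h
  simp only [map_smul, Module.Basis.repr_self, Finsupp.smul_apply, Finsupp.single_apply,
    if_true, smul_eq_mul, mul_one] at h2
  rw [← D.vec_toV u h1]
  by_contra h3
  have h4 : D.toV u h1 ≠ v := fun h4 => h3 (congrArg D.vec h4)
  rw [if_neg h4, mul_zero] at h2
  exact hc h2.symm

section PermutationAntipode

variable {D} {S : D.Alg →ₗ[K] D.Alg} {σ : Equiv.Perm D.V} {c : D.V → K}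

theorem permutation_scalar_ne_zero (hS : Function.Injective S)
    (hσ : ∀ v, S (D.mon (D.vec v)) = c v • D.mon (D.vec (σ v))) (v : D.V) : c v ≠ 0 := by
  intro h
  have := hσ v
  rw [h, zero_smul, ← map_zero S] at this
  exact D.mon_vec_ne_zero v (hS this)

theorem permutation_bot (hS : Function.Injective S) (h1 : S 1 = 1)
    (hσ : ∀ v, S (D.mon (D.vec v)) = c v • D.mon (D.vec (σ v))) : σ D.bot = D.bot := by
  have h := hσ D.bot
  rw [vec_bot, mon_zero, h1, ← D.mon_zero, ← D.vec_bot, ← one_smul K (D.mon (D.vec D.bot))] at h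
  exact (D.vec_injective (D.vec_eq_of_smul_mon_eq (permutation_scalar_ne_zero hS hσ _) h)).symm

/-- Write w = σ(e_i) ≠ 0 as u + e_k. Then S(x_{σ⁻¹(e_k)} x_{σ⁻¹(u)}) is a nonzero multiple of
S(x_i), so σ⁻¹(e_k) + σ⁻¹(u) = e_i. The first summand is nonzero, so the second is 0, whence u = 0
and w = e_k. -/
theorem exists_permutation_unitV (hS : Function.Injective S) (h1 : S 1 = 1)
    (hm : ∀ a b, S (a * b) = S b * S a)
    (hσ : ∀ v, S (D.mon (D.vec v)) = c v • D.mon (D.vec (σ v))) (i : Fin n) : ∃ k, σ (D.unitV i) = D.unitV k := by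
  have hc := permutation_scalar_ne_zero hS hσ
  have hb := permutation_bot hS h1 hσ
  set w := σ (D.unitV i) with hw
  have hw0 : D.vec w ≠ 0 := by
    intro h
    have h2 : w = D.bot := D.vec_injective h
    rw [← hb] at h2
    exact D.unitV_ne_bot i (σ.injective h2)
  obtain ⟨k, hk⟩ := Function.ne_iff.1 hw0
  have hwk : D.vec w - Pi.single k 1 + Pi.single k 1 = D.vec w := by
    funext j
    by_cases hj : j = k
    · subst hj; simp at hk ⊢; omega
    · simp [hj]
  let u : D.V := D.toV (D.vec w - Pi.single k 1) fun j =>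
    lt_of_le_of_lt (Nat.sub_le _ _) (w j).2
  have hu : D.vec u + D.vec (D.unitV k) = D.vec w := hwk
  refine ⟨k, ?_⟩
  have hSu := hσ (σ.symm u)
  have hSk := hσ (σ.symm (D.unitV k))
  rw [Equiv.apply_symm_apply] at hSu hSk
  have hprod : S (D.mon (D.vec (σ.symm (D.unitV k))) * D.mon (D.vec (σ.symm u))) =
      S (((c (σ.symm u) * c (σ.symm (D.unitV k)) * D.natPairing (D.vec u) (D.vec (D.unitV k))) *
        (c (D.unitV i))⁻¹) • D.mon (D.vec (D.unitV i))) := by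
    rw [hm, hSu, hSk, map_smul, hσ, ← hw, smul_smul, inv_mul_cancel_right₀ (hc _),
      smul_mul_smul_comm, mon_mul_mon, smul_smul, hu]
  have hprod := hS hprod
  rw [mon_mul_mon] at hprod
  have h2 := D.vec_eq_of_smul_mon_eq (mul_ne_zero (mul_ne_zero (mul_ne_zero (hc _) (hc _))
    (D.natPairing_ne_zero _ _)) (inv_ne_zero (hc _))) hprod
  have h3 : D.vec (σ.symm u) = 0 := by
    have h4 : D.vec (σ.symm (D.unitV k)) ≠ 0 := by
      intro h
      have h5 : σ.symm (D.unitV k) = D.bot := D.vec_injective h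
      rw [Equiv.symm_apply_eq, hb] at h5
      exact D.unitV_ne_bot k h5
    obtain ⟨j, hj⟩ := Function.ne_iff.1 h4
    have h6 := fun l => congrFun h2 l
    simp only [vec_unitV, Pi.add_apply] at h6
    funext l
    by_cases hl : l = i
    · subst hl
      by_cases hjl : j = l
      · subst hjl
        have := h6 j
        rw [Pi.single_eq_same] at this
        simp only [Pi.zero_apply] at hj ⊢
        omega
      · have := h6 j
        rw [Pi.single_eq_of_ne hjl] at this
        simp only [Pi.zero_apply] at hj ⊢
        omega
    · have := h6 l
      rw [Pi.single_eq_of_ne hl] at this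
      simp only [Pi.zero_apply]
      omega
  have h4 : σ.symm u = D.bot := D.vec_injective h3
  rw [Equiv.symm_apply_eq, hb] at h4
  apply D.vec_injective
  rw [← hu, h4, vec_bot, zero_add]

theorem exists_perm_fin (hS : Function.Injective S) (h1 : S 1 = 1)
    (hm : ∀ a b, S (a * b) = S b * S a)
    (hσ : ∀ v, S (D.mon (D.vec v)) = c v • D.mon (D.vec (σ v))) : ∃ (π : Equiv.Perm (Fin n)) (b : Fin n → K),
    (∀ i, b i ≠ 0) ∧ ∀ i, S (D.x i) = b i • D.x (π i) := by
  choose p hp using exists_permutation_unitV hS h1 hm hσ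
  have hinj : Function.Injective p := by
    intro i j hij
    apply D.unitV_injective
    apply σ.injective
    rw [hp, hp, hij]
  refine ⟨Equiv.ofBijective p (Finite.injective_iff_bijective.1 hinj), fun i => c (D.unitV i),
    fun i => permutation_scalar_ne_zero hS hσ _, fun i => ?_⟩
  rw [← mon_unitV, hσ, hp, mon_unitV]
  rfl

end PermutationAntipode

theorem x_mul_x_ne_zero {i j : Fin n} (hij : i ≠ j) : D.x i * D.x j ≠ 0 := by
  have h : ∀ k, (Pi.single i 1 + Pi.single j 1 : Fin n → ℕ) k < D.a k := by
    intro k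
    have := D.two_le_a k
    by_cases hk : k = i
    · subst hk; simp [hij]; omega
    · have := D.single_lt j k
      simpa [hk] using this
  rw [← mon_single, mon_mul_x, ← D.vec_toV _ h]
  exact smul_ne_zero (D.natPairing_ne_zero _ _) (D.mon_vec_ne_zero _)

theorem mon_single_eq (i : Fin n) (m : ℕ) : D.mon (Pi.single i m) = D.x i ^ m := by
  induction m with
  | zero => simp [mon_zero]
  | succ m ih =>
    have h := D.x_mul_mon_eq i (Pi.single i m)
    have hc : D.coef i (Pi.single i m) = 1 := Finset.prod_eq_one fun k hk => by
      simp [(Finset.mem_Iio.1 hk).ne]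
    rw [hc, one_smul, ← Pi.single_add] at h
    rw [← h, ih, pow_succ']

theorem x_pow_ne_zero {i : Fin n} {m : ℕ} (h : m < D.a i) : D.x i ^ m ≠ 0 := by
  have h1 : ∀ k, (Pi.single i m : Fin n → ℕ) k < D.a k := by
    intro k
    have := D.two_le_a k
    by_cases hk : k = i
    · subst hk; simpa using h
    · simp [hk]; omega
  rw [← mon_single_eq, ← D.vec_toV _ h1]
  exact D.mon_vec_ne_zero _

/-- Comparing nilpotency orders of x_i and x_{π(i)} gives the condition on a; reversing products in
the commutation relation transposes q. -/
theorem isCompatible_of_antiautomorphism {S : D.Alg →ₗ[K] D.Alg} (hS : Function.Injective S)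
    (h1 : S 1 = 1) (hm : ∀ a b, S (a * b) = S b * S a) {π : Equiv.Perm (Fin n)} {b : Fin n → K}
    (hb : ∀ i, b i ≠ 0) (hx : ∀ i, S (D.x i) = b i • D.x (π i)) : D.IsCompatible π := by
  have hp : ∀ i m, S (D.x i ^ m) = b i ^ m • D.x (π i) ^ m := by
    intro i m
    induction m with
    | zero => simp [h1]
    | succ m ih => rw [pow_succ, hm, ih, hx, smul_mul_smul_comm, ← pow_succ', ← pow_succ']
  refine ⟨fun i => le_antisymm ?_ ?_, fun i j => ?_⟩
  · by_contra! h
    have h2 := hp i (D.a i)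
    rw [x_pow, map_zero] at h2
    exact smul_ne_zero (pow_ne_zero _ (hb i)) (D.x_pow_ne_zero h) h2.symm
  · by_contra! h
    have h2 := hp i (D.a (π i))
    rw [x_pow, smul_zero, ← map_zero S] at h2
    exact D.x_pow_ne_zero h (hS h2)
  · by_cases hij : i = j
    · subst hij; rw [q_self, q_self]
    · have h2 := congrArg S (D.x_mul_x j i)
      rw [hm, map_smul, hm, hx, hx, smul_mul_smul_comm, smul_mul_smul_comm,
        D.x_mul_x (π i) (π j), smul_smul, smul_smul, ← sub_eq_zero, ← sub_smul] at h2
      have h3 := (smul_eq_zero.1 h2).resolve_right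
        (D.x_mul_x_ne_zero fun h => hij (π.injective h))
      have h4 : b i * b j ≠ 0 := mul_ne_zero (hb i) (hb j)
      exact mul_left_cancel₀ h4 (by linear_combination h3)

theorem compl_unitV_add_single (i : Fin n) :
    D.compl (D.unitV i) + Pi.single i 1 = D.vec D.top :=
  (D.compl_add_vec _ _).2 rfl

/-- After reindexing by π, each factor q_{π(k)π(i)} equals q_{ik} = q_{ki}⁻¹. -/
theorem nakayamaScalar_mul_apply {π : Equiv.Perm (Fin n)} (hπ : D.IsCompatible π)
    (i : Fin n) : D.nakayamaScalar (π i) * D.nakayamaScalar i = 1 := by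
  unfold nakayamaScalar
  rw [← Equiv.prod_comp π, ← Finset.prod_mul_distrib]
  refine Finset.prod_eq_one fun k _ => ?_
  rw [hπ.1, hπ.2, ← mul_pow, q_mul_q, one_pow]

theorem nakayamaScalar_eq_one_and_exists_isCompatible [CharP K 2]
    (h : D.AdmitsPermutationBiFrobenius) :
    (∀ i, D.nakayamaScalar i = 1) ∧
      ∃ π : Equiv.Perm (Fin n), D.IsCompatible π ∧ π * π = 1 := by
  obtain ⟨B, σ, c, hσ⟩ := h
  obtain ⟨π, b, hb, hx⟩ := exists_perm_fin B.S_injective B.S_one B.S_mul hσ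
  have hπ := D.isCompatible_of_antiautomorphism B.S_injective B.S_one B.S_mul hb hx
  have hφ : B.φ (D.mon (D.vec D.top)) ≠ 0 :=
    right_ne_zero_of_mul_eq_one (D.topDual_t_mul_φ_top B)
  have hne : ∀ i, B.φ (D.mon (D.compl (D.unitV i)) * D.x i) ≠ 0 := by
    intro i
    rw [mon_mul_x, compl_unitV_add_single, map_smul]
    exact smul_ne_zero (D.natPairing_ne_zero _ _) hφ
  have hS2 : ∀ i, B.S (B.S (D.x i)) = (b i * b (π i)) • D.x (π (π i)) := by
    intro i
    rw [hx, map_smul, hx, smul_smul]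
  -- The test pair x_{a-1-e_i}, x_i has product a nonzero multiple of x_{a-1}, on which φ does not
  -- vanish.
  have hkey := fun i => D.φ_S_S_mul_eq B (D.mon (D.compl (D.unitV i))) (D.x i)
  have hππ : ∀ i, π (π i) = i := by
    intro i
    by_contra hi
    apply hne i
    -- If π²(i) ≠ i, the exponent of x_{π²(i)} in x_{a-1-e_i} is already maximal, so one more factor
    -- gives 0.
    rw [← hkey, hS2, smul_mul_assoc, x_mul_mon_eq, D.mon_eq_zero _ (π (π i)), smul_zero, smul_zero,
      map_zero]
    have h2 := congrFun (D.compl_unitV_add_single i) (π (π i))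
    rw [Pi.add_apply, Pi.single_eq_of_ne hi, vec_top_apply] at h2
    rw [Pi.add_apply, Pi.single_eq_same]
    omega
  have hπ2 : π * π = 1 := Equiv.ext hππ
  have hbb : ∀ i, b i * b (π i) * D.nakayamaScalar i = 1 := by
    intro i
    have h2 := hkey i
    rw [hS2, hππ, smul_mul_assoc, x_mul_mon_comm,
      D.prod_q_pow_of_add_single i _ (D.compl_unitV_add_single i), smul_smul, map_smul,
      smul_eq_mul] at h2
    exact mul_right_cancel₀ (hne i) (h2.trans (one_mul _).symm)
  refine ⟨fun i => eq_one_of_sq_eq_one ?_, π, hπ, hπ2⟩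
  -- The product b_i b_{π(i)} is symmetric under i ↔ π(i), hence so is h.
  have e1 := hbb i
  have e2 := hbb (π i)
  rw [hππ, mul_comm (b (π i))] at e2
  have e3 : D.nakayamaScalar (π i) = D.nakayamaScalar i :=
    mul_left_cancel₀ (mul_ne_zero (hb i) (hb _)) (e2.trans e1.symm)
  have e4 := D.nakayamaScalar_mul_apply hπ i
  rw [e3] at e4
  rw [sq, e4]

end QCIData

namespace QCIData

variable {K : Type*} [Field K] {n : ℕ} (D : QCIData K n)

/-! #### The anti-automorphism of a compatible permutation -/

theorem pairing_single (a b : Fin n) :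
    D.pairing (Pi.single a 1) (Pi.single b 1) = if b < a then D.q b a else 1 := by
  have h : D.pairing (Pi.single a 1) (Pi.single b 1) =
      D.natPairing (0 + Pi.single a 1) (Pi.single b 1) := by
    rw [zero_add]
    unfold natPairing
    congr 1 <;> funext i <;> simp [Pi.single_apply]
  rw [h, natPairing_add_single, natPairing_zero_left, one_mul]
  have : ∀ k, D.q k a ^ (Pi.single b 1 : Fin n → ℕ) k = if k = b then D.q b a else 1 := by
    intro k
    by_cases hk : k = b
    · subst hk; simp
    · simp [hk]
  simp only [coef, this, Finset.prod_ite_eq', Finset.mem_Iio]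

/-- Only pairs j < k containing i change, and j ≠ k excludes a quadratic term in e_i. -/
theorem prod_pow_add_single (f : Fin n → Fin n → K) (v : Fin n → ℕ) (i : Fin n) :
    ∏ j, ∏ k ∈ Finset.Ioi j, f j k ^
        ((v + Pi.single i 1 : Fin n → ℕ) j * (v + Pi.single i 1 : Fin n → ℕ) k) =
      (∏ j, ∏ k ∈ Finset.Ioi j, f j k ^ (v j * v k)) *
        ((∏ k ∈ Finset.Ioi i, f i k ^ v k) * ∏ k ∈ Finset.Iio i, f k i ^ v k) := by
  have h : ∀ j, ∀ k ∈ Finset.Ioi j, f j k ^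
      ((v + Pi.single i 1 : Fin n → ℕ) j * (v + Pi.single i 1 : Fin n → ℕ) k) =
      f j k ^ (v j * v k) * (if j = i then f i k ^ v k else 1) *
        (if k = i then f j i ^ v j else 1) := by
    intro j k hk
    have hjk := (Finset.mem_Ioi.1 hk).ne
    by_cases hj : j = i
    · subst hj
      simp [hjk.symm, add_mul, pow_add]
    · by_cases hk' : k = i
      · subst hk'
        simp [hj, mul_add, pow_add]
      · simp [hj, hk']
  rw [Finset.prod_congr rfl fun j _ => Finset.prod_congr rfl (h j)]
  simp only [Finset.prod_mul_distrib, Finset.prod_ite_eq', Finset.mem_Ioi]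
  rw [mul_assoc]
  congr 2
  · rw [Finset.prod_eq_single i]
    · simp
    · intro j _ hj
      simp [hj]
    · simp
  · rw [← Finset.prod_filter]
    congr 1
    ext; simp

theorem antipodeCoeff_one_eq (π : Equiv.Perm (Fin n)) (v : Fin n → ℕ) :
    D.antipodeCoeff π 1 v = ∏ j, ∏ k ∈ Finset.Ioi j,
      (if π j < π k then D.q (π j) (π k) else 1) ^ (v j * v k) := by
  simp [antipodeCoeff, pairing_single]

theorem antipodeCoeff_zero (π : Equiv.Perm (Fin n)) : D.antipodeCoeff π 1 0 = 1 := by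
  simp [antipodeCoeff_one_eq]

/-- This is the recursion forced by S(x_i x_v) = S(x_v) x_{π(i)}; it is checked one index k at a
time, according to the orders of i, k and of π(i), π(k). -/
theorem antipodeCoeff_add_single {π : Equiv.Perm (Fin n)} (hπ : D.IsCompatible π)
    (v : Fin n → ℕ) (i : Fin n) :
    D.antipodeCoeff π 1 (v + Pi.single i 1) * D.coef i v =
      D.antipodeCoeff π 1 v * D.natPairing (permVec π v) (Pi.single (π i) 1) := by
  rw [antipodeCoeff_one_eq, antipodeCoeff_one_eq, prod_pow_add_single, mul_assoc]
  congr 1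
  have hr : D.natPairing (permVec π v) (Pi.single (π i) 1) =
      ∏ k, if π i < π k then D.q (π i) (π k) ^ v k else 1 := by
    have e : Finset.Ioi (π i) = Finset.univ.filter fun k => π i < k := by ext; simp
    rw [natPairing_single_right, e, Finset.prod_filter, ← Equiv.prod_comp π]
    simp only [permVec, show ∀ k, π⁻¹ (π k) = k from π.symm_apply_apply]
  have e1 : Finset.Ioi i = Finset.univ.filter fun k => i < k := by ext; simp
  have e2 : Finset.Iio i = Finset.univ.filter fun k => k < i := by ext; simp
  rw [hr, coef, e1, e2, Finset.prod_filter, Finset.prod_filter, Finset.prod_filter,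
    ← Finset.prod_mul_distrib, ← Finset.prod_mul_distrib]
  refine Finset.prod_congr rfl fun k _ => ?_
  rcases lt_trichotomy i k with h | h | h
  · simp only [h, h.not_gt, if_true, if_false, mul_one]
    split_ifs <;> simp
  · subst h; simp
  · have hne : π i ≠ π k := fun h' => h.ne' (π.injective h')
    simp only [h, h.not_gt, if_true, if_false, one_mul]
    rcases lt_or_gt_of_ne hne with h' | h'
    · simp [h', h'.not_gt, hπ.2]
    -- Here π preserves k < i, and q_{π(k)π(i)} cancels q_{ki} by compatibility.
    · simp only [h', h'.not_gt, if_true, if_false, ← mul_pow]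
      rw [← hπ.2 i k, q_mul_q, one_pow]

/-- The algebra homomorphism `A → A^op` with `x_i ↦ x_{π(i)}`. -/
noncomputable def opHom {π : Equiv.Perm (Fin n)} (hπ : D.IsCompatible π) :
    D.Alg →ₐ[K] (D.Alg)ᵐᵒᵖ :=
  RingQuot.liftAlgHom K ⟨FreeAlgebra.lift K fun i => MulOpposite.op (D.x (π i)), by
    rintro _ _ (i | ⟨i, j⟩)
    · rw [map_pow, FreeAlgebra.lift_ι_apply, map_zero, ← MulOpposite.op_pow, ← hπ.1 i, x_pow,
        MulOpposite.op_zero]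
    · simp only [map_mul, map_smul, FreeAlgebra.lift_ι_apply]
      rw [← MulOpposite.op_mul, ← MulOpposite.op_mul, ← MulOpposite.op_smul, D.x_mul_x (π j) (π i),
        hπ.2]⟩

theorem opHom_x {π : Equiv.Perm (Fin n)} (hπ : D.IsCompatible π) (i : Fin n) :
    D.opHom hπ (D.x i) = MulOpposite.op (D.x (π i)) := by
  unfold opHom x proj
  erw [RingQuot.liftAlgHom_mkAlgHom_apply]
  simp

/-- The linear map underlying the anti-endomorphism with `x_i ↦ x_{π(i)}`. -/
noncomputable def antiMap {π : Equiv.Perm (Fin n)} (hπ : D.IsCompatible π) :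
    D.Alg →ₗ[K] D.Alg :=
  (MulOpposite.opLinearEquiv K).symm.toLinearMap ∘ₗ (D.opHom hπ).toLinearMap

variable {D} {π : Equiv.Perm (Fin n)} (hπ : D.IsCompatible π)

theorem antiMap_x (i : Fin n) : D.antiMap hπ (D.x i) = D.x (π i) := by
  simp [antiMap, opHom_x]

theorem antiMap_one : D.antiMap hπ 1 = 1 := by
  simp [antiMap]

theorem antiMap_mul (a b : D.Alg) :
    D.antiMap hπ (a * b) = D.antiMap hπ b * D.antiMap hπ a := by
  simp [antiMap]

theorem antiMap_mon (v : Fin n → ℕ) :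
    D.antiMap hπ (D.mon v) = D.antipodeCoeff π 1 v • D.mon (permVec π v) := by
  induction v using exponent_induction with
  | h0 =>
    rw [antipodeCoeff_zero, mon_zero, antiMap_one, one_smul]
    exact D.mon_zero.symm
  | h1 i v ih =>
    have h := congrArg (D.antiMap hπ) (D.x_mul_mon_eq i v)
    have hp : permVec π (v + Pi.single i 1) = permVec π v + Pi.single (π i) 1 := by
      funext k
      simp only [permVec, Pi.add_apply, Pi.single_apply, Equiv.Perm.inv_eq_iff_eq]
    rw [antiMap_mul, antiMap_x, ih, map_smul, smul_mul_assoc, mon_mul_x, smul_smul,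
      ← D.antipodeCoeff_add_single hπ, mul_comm, mul_smul, ← hp] at h
    exact (smul_right_injective _ (D.coef_ne_zero i v) h).symm

/-- Replaces the scalar formula by a map built from the presentation, for which
anti-multiplicativity is automatic. -/
theorem explicitAntipode_eq : D.explicitAntipode π 1 = D.antiMap hπ := by
  refine D.basis.ext fun v => ?_
  rw [explicitAntipode, Module.Basis.constr_basis, basis_apply, antiMap_mon]

theorem antiMap_antiMap (hπ2 : π * π = 1) (z : D.Alg) : D.antiMap hπ (D.antiMap hπ z) = z := by
  induction z using D.alg_induction with
  | hc r => simp only [Algebra.algebraMap_eq_smul_one, map_smul, antiMap_one]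
  | hx i =>
    rw [antiMap_x, antiMap_x, ← Equiv.Perm.mul_apply, hπ2]
    rfl
  | hm a b ha hb => rw [antiMap_mul, antiMap_mul, ha, hb]
  | ha a b ha hb => rw [map_add, map_add, ha, hb]

/-- The permutation of `V` induced by a compatible permutation. -/
def permV (hπ : D.IsCompatible π) (hπ2 : π * π = 1) : Equiv.Perm D.V :=
  Function.Involutive.toPerm
    (fun v => D.toV (permVec π (D.vec v)) fun i => by
      have h := (v (π⁻¹ i)).2
      have h2 := hπ.1 (π⁻¹ i)
      rw [show π (π⁻¹ i) = i from π.apply_symm_apply i] at h2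
      exact lt_of_lt_of_eq h h2.symm)
    fun v => D.vec_injective (funext fun i => by
      change D.vec v (π⁻¹ (π⁻¹ i)) = D.vec v i
      rw [← Equiv.Perm.mul_apply, ← mul_inv_rev, hπ2]
      rfl)

theorem vec_permV (hπ2 : π * π = 1) (v : D.V) :
    D.vec (permV hπ hπ2 v) = permVec π (D.vec v) := rfl

theorem antiMap_mon_vec (hπ2 : π * π = 1) (v : D.V) :
    D.antiMap hπ (D.mon (D.vec v)) =
      D.antipodeCoeff π 1 (D.vec v) • D.mon (D.vec (permV hπ hπ2 v)) :=
  antiMap_mon hπ _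

theorem permV_bot (hπ2 : π * π = 1) : permV hπ hπ2 D.bot = D.bot := rfl

theorem permV_top (hπ2 : π * π = 1) : permV hπ hπ2 D.top = D.top := by
  apply D.vec_injective
  funext i
  rw [vec_permV, permVec, vec_top_apply, vec_top_apply, ← hπ.1 (π⁻¹ i),
    show π (π⁻¹ i) = i from π.apply_symm_apply i]

/-- S scales x_{a-1} by some c, and S² = 1 gives c² = 1, so c = 1 in characteristic 2. -/
theorem antiMap_top [CharP K 2] (hπ2 : π * π = 1) :
    D.antiMap hπ (D.mon (D.vec D.top)) = D.mon (D.vec D.top) := by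
  have h := antiMap_mon_vec hπ hπ2 D.top
  rw [permV_top] at h
  have h2 := antiMap_antiMap hπ hπ2 (D.mon (D.vec D.top))
  rw [h, map_smul, h, smul_smul, ← sub_eq_zero] at h2
  nth_rewrite 2 [← one_smul K (D.mon (D.vec D.top))] at h2
  rw [← sub_smul] at h2
  have h3 := (smul_eq_zero.1 h2).resolve_right (D.mon_vec_ne_zero _)
  rw [← sq] at h3
  rw [h, eq_one_of_sq_eq_one (sub_eq_zero.1 h3), one_smul]

/-! #### The explicit bi-Frobenius structure -/

end QCIData

namespace QCIData

variable {K : Type*} [Field K] {n : ℕ} {D : QCIData K n} {π : Equiv.Perm (Fin n)}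

/-! #### The explicit bi-Frobenius structure -/

variable (D) in
theorem top_ne_bot : D.top ≠ D.bot := by
  intro h
  have h2 := D.two_le_n
  have h1 := congrFun (congrArg D.vec h) ⟨0, by omega⟩
  have := D.two_le_a ⟨0, by omega⟩
  rw [vec_bot, vec_top_apply, Pi.zero_apply] at h1
  omega

variable (D) in
theorem explicitComul_one (π : Equiv.Perm (Fin n)) : D.explicitComul π 1 1 = 1 ⊗ₜ[K] 1 := by
  conv_lhs => rw [← mon_zero, ← D.vec_bot, ← basis_apply]
  rw [explicitComul, Module.Basis.constr_basis, if_pos rfl]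

theorem explicitComul_of_ne {v : D.V} (h1 : v ≠ D.bot) (h2 : v ≠ D.top) :
    D.explicitComul π 1 (D.mon (D.vec v)) =
      1 ⊗ₜ[K] D.mon (D.vec v) + D.mon (D.vec v) ⊗ₜ[K] 1 := by
  conv_lhs => rw [← basis_apply]
  rw [explicitComul, Module.Basis.constr_basis, if_neg h1, if_neg h2]

/-- In this form Δ(x_{a-1}) is (id ⊗ S) of the dual-basis tensor of ψ. -/
theorem explicitComul_top (hπ : D.IsCompatible π) :
    D.explicitComul π 1 (D.mon (D.vec D.top)) =
      ∑ w : D.V, (D.natPairing (D.compl w) (D.vec w))⁻¹ •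
        (D.mon (D.compl w) ⊗ₜ[K] D.antiMap hπ (D.mon (D.vec w))) := by
  conv_lhs => rw [← basis_apply]
  rw [explicitComul, Module.Basis.constr_basis, if_neg D.top_ne_bot, if_pos rfl]
  refine Finset.sum_congr rfl fun w _ => ?_
  rw [antiMap_mon, TensorProduct.tmul_smul, smul_smul]
  rfl

theorem complEquiv_bot : D.complEquiv D.bot = D.top := by
  apply D.vec_injective
  rw [vec_complEquiv]
  rfl

theorem complEquiv_top : D.complEquiv D.top = D.bot := by
  rw [← complEquiv_bot, complEquiv_complEquiv]

/-- Splits off w = 0 and w = a-1; in the remaining terms both tensor factors are primitive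
monomials. -/
theorem explicitComul_top_eq_add [CharP K 2] (hπ : D.IsCompatible π) (hπ2 : π * π = 1) :
    ∃ c : D.V → K, D.explicitComul π 1 (D.mon (D.vec D.top)) =
      D.mon (D.vec D.top) ⊗ₜ[K] 1 + 1 ⊗ₜ[K] D.mon (D.vec D.top) +
      ∑ w ∈ (Finset.univ.erase D.top).erase D.bot, c w •
        (D.mon (D.vec (D.complEquiv w)) ⊗ₜ[K] D.mon (D.vec (permV hπ hπ2 w))) := by
  refine ⟨fun w => (D.natPairing (D.compl w) (D.vec w))⁻¹ * D.antipodeCoeff π 1 (D.vec w), ?_⟩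
  rw [explicitComul_top hπ, ← Finset.add_sum_erase _ _ (Finset.mem_univ D.top),
    ← Finset.add_sum_erase _ _ (Finset.mem_erase.2 ⟨D.top_ne_bot.symm, Finset.mem_univ D.bot⟩),
    ← add_assoc, add_comm (_ • _) (_ • _)]
  congr 1
  · rw [antiMap_top hπ hπ2, ← vec_complEquiv, ← vec_complEquiv, complEquiv_bot, complEquiv_top,
      vec_bot, mon_zero, antiMap_one, natPairing_zero_left, natPairing_zero_right, inv_one,
      one_smul, one_smul]
  · refine Finset.sum_congr rfl fun w _ => ?_
    rw [antiMap_mon_vec hπ hπ2, vec_complEquiv, TensorProduct.tmul_smul, smul_smul]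

theorem explicitCounit_mon_vec (v : D.V) :
    D.explicitCounit (D.mon (D.vec v)) = if v = D.bot then 1 else 0 := by
  rw [← basis_apply, explicitCounit, Module.Basis.coord_apply, Module.Basis.repr_self,
    Finsupp.single_apply]

theorem explicitCounit_one : D.explicitCounit 1 = 1 := by
  rw [← mon_zero, ← D.vec_bot, explicitCounit_mon_vec, if_pos rfl]

theorem explicitCounit_eq_topDual_left (z : D.Alg) :
    D.explicitCounit z = D.topDual (D.mon (D.vec D.top) * z) := by
  induction D.span_mon (Submodule.mem_top (x := z)) using Submodule.span_induction with
  | mem z hz =>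
    obtain ⟨w, rfl⟩ := hz
    have hw : D.vec w = 0 ↔ w = D.bot := by rw [← D.vec_bot, D.vec_injective.eq_iff]
    simp only [explicitCounit_mon_vec, topDual_top_mul_mon, hw]
  | zero => simp
  | add y z _ _ hy hz => rw [mul_add, map_add, map_add, hy, hz]
  | smul c z _ hz => rw [mul_smul_comm, map_smul, map_smul, hz]

/-- ε(z) = ψ(x_{a-1} z) and x_{a-1} a = ε(a) x_{a-1}, so ε(ab) = ψ(x_{a-1}ab) = ε(a)ε(b). -/
theorem explicitCounit_mul (a b : D.Alg) :
    D.explicitCounit (a * b) = D.explicitCounit a * D.explicitCounit b := by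
  have h : D.mon (D.vec D.top) * a = D.explicitCounit a • D.mon (D.vec D.top) := by
    rw [← sub_eq_zero]
    induction D.span_mon (Submodule.mem_top (x := a)) using Submodule.span_induction with
    | mem z hz =>
      obtain ⟨w, rfl⟩ := hz
      simp only [explicitCounit_mon_vec]
      by_cases hw : w = D.bot
      · subst hw; simp [vec_bot, mon_zero]
      · obtain ⟨i, hi⟩ := Function.ne_iff.1 fun h : D.vec w = 0 => hw (D.vec_injective h)
        rw [if_neg hw, zero_smul, sub_zero, mon_mul_mon, D.mon_eq_zero _ i, smul_zero]
        rw [Pi.add_apply, vec_top_apply]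
        rw [Pi.zero_apply] at hi
        omega
    | zero => simp
    | add y z _ _ hy hz =>
      rw [mul_add, map_add, add_smul, add_sub_add_comm, hy, hz, add_zero]
    | smul c z _ hz => rw [mul_smul_comm, map_smul, smul_assoc, ← smul_sub, hz, smul_zero]
  rw [explicitCounit_eq_topDual_left, ← mul_assoc, h, smul_mul_assoc, map_smul,
    ← explicitCounit_eq_topDual_left, smul_eq_mul]

/-- The coalgebra structure given by the explicit counit and comultiplication. -/
@[reducible] noncomputable def explicitCoalgebra [CharP K 2] (hπ : D.IsCompatible π)
    (hπ2 : π * π = 1) : Coalgebra K D.Alg where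
  comul := D.explicitComul π 1
  counit := D.explicitCounit
  coassoc := by
    refine D.basis.ext fun v => ?_
    simp only [LinearMap.comp_apply, basis_apply, LinearEquiv.coe_coe]
    by_cases h1 : v = D.bot
    · subst h1
      rw [vec_bot, mon_zero, explicitComul_one]
      simp [explicitComul_one]
    · by_cases h2 : v = D.top
      · subst h2
        obtain ⟨c, hc⟩ := explicitComul_top_eq_add hπ hπ2
        have hr : ∀ w ∈ (Finset.univ.erase D.top).erase D.bot,
            D.explicitComul π 1 (D.mon (D.vec (D.complEquiv w))) =
              1 ⊗ₜ[K] D.mon (D.vec (D.complEquiv w)) +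
                D.mon (D.vec (D.complEquiv w)) ⊗ₜ[K] 1 := by
          intro w hw
          simp only [Finset.mem_erase, Finset.mem_univ, and_true] at hw
          refine explicitComul_of_ne ?_ ?_
          · rw [← complEquiv_top]; exact fun h => hw.2 (D.complEquiv.injective h)
          · rw [← complEquiv_bot]; exact fun h => hw.1 (D.complEquiv.injective h)
        have hl : ∀ w ∈ (Finset.univ.erase D.top).erase D.bot,
            D.explicitComul π 1 (D.mon (D.vec (permV hπ hπ2 w))) =
              1 ⊗ₜ[K] D.mon (D.vec (permV hπ hπ2 w)) +
                D.mon (D.vec (permV hπ hπ2 w)) ⊗ₜ[K] 1 := by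
          intro w hw
          simp only [Finset.mem_erase, Finset.mem_univ, and_true] at hw
          refine explicitComul_of_ne ?_ ?_
          · rw [← permV_bot hπ hπ2]; exact fun h => hw.1 ((permV hπ hπ2).injective h)
          · rw [← permV_top hπ hπ2]; exact fun h => hw.2 ((permV hπ hπ2).injective h)
        -- With R = ∑ c x ⊗ y the remainder, (Δ ⊗ id)R = 1 ⊗ R + ∑ c x ⊗ 1 ⊗ y and (id ⊗ Δ)R = ∑ c x
        -- ⊗ 1 ⊗ y + R ⊗ 1. The missing R ⊗ 1 and 1 ⊗ R come from Δ(x_{a-1}) ⊗ 1 and 1 ⊗ Δ(x_{a-1}).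
        have e1 : TensorProduct.assoc K D.Alg D.Alg D.Alg (LinearMap.rTensor D.Alg
            (D.explicitComul π 1) (∑ w ∈ (Finset.univ.erase D.top).erase D.bot, c w •
              (D.mon (D.vec (D.complEquiv w)) ⊗ₜ[K] D.mon (D.vec (permV hπ hπ2 w))))) =
            1 ⊗ₜ[K] (∑ w ∈ (Finset.univ.erase D.top).erase D.bot, c w •
              (D.mon (D.vec (D.complEquiv w)) ⊗ₜ[K] D.mon (D.vec (permV hπ hπ2 w)))) +
            ∑ w ∈ (Finset.univ.erase D.top).erase D.bot, c w •
              (D.mon (D.vec (D.complEquiv w)) ⊗ₜ[K] (1 ⊗ₜ[K] D.mon (D.vec (permV hπ hπ2 w)))) := by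
          rw [map_sum, map_sum, TensorProduct.tmul_sum, ← Finset.sum_add_distrib]
          refine Finset.sum_congr rfl fun w hw => ?_
          rw [map_smul, map_smul, LinearMap.rTensor_tmul, hr w hw, TensorProduct.add_tmul, map_add,
            TensorProduct.assoc_tmul, TensorProduct.assoc_tmul, smul_add, TensorProduct.tmul_smul]
        have e2 : LinearMap.lTensor D.Alg
            (D.explicitComul π 1) (∑ w ∈ (Finset.univ.erase D.top).erase D.bot, c w •
              (D.mon (D.vec (D.complEquiv w)) ⊗ₜ[K] D.mon (D.vec (permV hπ hπ2 w)))) =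
            ∑ w ∈ (Finset.univ.erase D.top).erase D.bot, c w •
              (D.mon (D.vec (D.complEquiv w)) ⊗ₜ[K] (1 ⊗ₜ[K] D.mon (D.vec (permV hπ hπ2 w)))) +
            TensorProduct.assoc K D.Alg D.Alg D.Alg
              ((∑ w ∈ (Finset.univ.erase D.top).erase D.bot, c w •
              (D.mon (D.vec (D.complEquiv w)) ⊗ₜ[K] D.mon (D.vec (permV hπ hπ2 w)))) ⊗ₜ[K] 1) := by
          rw [map_sum, TensorProduct.sum_tmul, map_sum, ← Finset.sum_add_distrib]
          refine Finset.sum_congr rfl fun w hw => ?_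
          rw [map_smul, LinearMap.lTensor_tmul, hl w hw, TensorProduct.tmul_add,
            smul_add, ← TensorProduct.smul_tmul', map_smul, TensorProduct.assoc_tmul]
        rw [hc, map_add, map_add, map_add, map_add, map_add, map_add, e1, e2]
        simp only [LinearMap.rTensor_tmul, LinearMap.lTensor_tmul, explicitComul_one, hc,
          TensorProduct.add_tmul, TensorProduct.tmul_add, map_add, TensorProduct.assoc_tmul]
        abel
      · rw [explicitComul_of_ne h1 h2]
        simp only [map_add, LinearMap.rTensor_tmul, LinearMap.lTensor_tmul, explicitComul_one,
          explicitComul_of_ne h1 h2, TensorProduct.add_tmul, TensorProduct.tmul_add,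
          TensorProduct.assoc_tmul]
        abel
  rTensor_counit_comp_comul := by
    refine D.basis.ext fun v => ?_
    simp only [LinearMap.comp_apply, basis_apply, TensorProduct.mk_apply]
    by_cases h1 : v = D.bot
    · subst h1
      rw [vec_bot, mon_zero, explicitComul_one, LinearMap.rTensor_tmul, explicitCounit_one]
    · by_cases h2 : v = D.top
      · subst h2
        obtain ⟨c, hc⟩ := explicitComul_top_eq_add hπ hπ2
        rw [hc, map_add, map_add, map_sum, Finset.sum_eq_zero]
        · simp [explicitCounit_one, explicitCounit_mon_vec, h1]
        · intro w hw
          simp only [Finset.mem_erase, Finset.mem_univ, and_true] at hw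
          rw [map_smul, LinearMap.rTensor_tmul, explicitCounit_mon_vec, if_neg,
            TensorProduct.zero_tmul, smul_zero]
          rw [← complEquiv_top]; exact fun h => hw.2 (D.complEquiv.injective h)
      · rw [explicitComul_of_ne h1 h2]
        simp [explicitCounit_one, explicitCounit_mon_vec, h1]
  lTensor_counit_comp_comul := by
    refine D.basis.ext fun v => ?_
    simp only [LinearMap.comp_apply, basis_apply, TensorProduct.mk_apply, LinearMap.flip_apply]
    by_cases h1 : v = D.bot
    · subst h1
      rw [vec_bot, mon_zero, explicitComul_one, LinearMap.lTensor_tmul, explicitCounit_one]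
    · by_cases h2 : v = D.top
      · subst h2
        obtain ⟨c, hc⟩ := explicitComul_top_eq_add hπ hπ2
        rw [hc, map_add, map_add, map_sum, Finset.sum_eq_zero]
        · simp [explicitCounit_one, explicitCounit_mon_vec, h1]
        · intro w hw
          simp only [Finset.mem_erase, Finset.mem_univ, and_true] at hw
          rw [map_smul, LinearMap.lTensor_tmul, explicitCounit_mon_vec, if_neg,
            TensorProduct.tmul_zero, smul_zero]
          rw [← permV_bot hπ hπ2]; exact fun h => hw.1 ((permV hπ hπ2).injective h)
      · rw [explicitComul_of_ne h1 h2]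
        simp [explicitCounit_one, explicitCounit_mon_vec, h1]

/-- Apply S to the dual-basis expansion of a. -/
theorem antiMap_eq_tensorContract (hπ : D.IsCompatible π) (a : D.Alg) :
    D.antiMap hπ a = tensorContract K (D.topDual ∘ₗ LinearMap.mulRight K a)
      (D.explicitComul π 1 (D.mon (D.vec D.top))) := by
  conv_lhs => rw [← D.sum_topDual_compl_mul a]
  rw [explicitComul_top hπ, tensorContract_sum, map_sum]
  refine Finset.sum_congr rfl fun w _ => ?_
  simp [smul_smul, mul_comm]

/-- The two scalars are the values of ψ on x_{a-1-v} x_v and x_v x_{a-1-v}. -/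
theorem natPairing_compl_comm (h : ∀ i, D.nakayamaScalar i = 1) (v : D.V) :
    D.natPairing (D.compl v) (D.vec v) = D.natPairing (D.vec v) (D.compl v) := by
  have h1 := D.topDual_mul_comm h (D.mon (D.compl v)) (D.mon (D.vec v))
  rwa [mon_mul_mon, mon_mul_mon, map_smul, map_smul, (D.compl_add_vec v v).2 rfl,
    (D.vec_add_compl v v).2 rfl, topDual_top, smul_eq_mul, smul_eq_mul, mul_one, mul_one] at h1

theorem explicitCounit_antiMap (hπ : D.IsCompatible π) (hπ2 : π * π = 1) (a : D.Alg) :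
    D.explicitCounit (D.antiMap hπ a) = D.explicitCounit a := by
  revert a
  refine LinearMap.congr_fun (f := D.explicitCounit ∘ₗ D.antiMap hπ) (D.basis.ext fun v => ?_)
  rw [LinearMap.comp_apply, basis_apply]
  by_cases h : v = D.bot
  · subst h
    rw [vec_bot, mon_zero, antiMap_one]
  · rw [antiMap_mon_vec hπ hπ2, map_smul, explicitCounit_mon_vec, explicitCounit_mon_vec,
      if_neg h, if_neg, smul_zero]
    rw [← permV_bot hπ hπ2]; exact fun h' => h ((permV hπ hπ2).injective h')

theorem explicitComul_antiMap [CharP K 2] (h : ∀ i, D.nakayamaScalar i = 1)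
    (hπ : D.IsCompatible π) (hπ2 : π * π = 1) (a : D.Alg) :
    D.explicitComul π 1 (D.antiMap hπ a) = TensorProduct.map (D.antiMap hπ) (D.antiMap hπ)
      (TensorProduct.comm K D.Alg D.Alg (D.explicitComul π 1 a)) := by
  revert a
  refine LinearMap.congr_fun (f := D.explicitComul π 1 ∘ₗ D.antiMap hπ)
    (g := TensorProduct.map (D.antiMap hπ) (D.antiMap hπ) ∘ₗ
      (TensorProduct.comm K D.Alg D.Alg).toLinearMap ∘ₗ D.explicitComul π 1)
    (D.basis.ext fun v => ?_)
  simp only [LinearMap.comp_apply, basis_apply, LinearEquiv.coe_coe]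
  by_cases h1 : v = D.bot
  · subst h1
    rw [vec_bot, mon_zero, antiMap_one, explicitComul_one]
    simp [antiMap_one]
  · by_cases h2 : v = D.top
    · subst h2
      -- Flipping and applying S ⊗ S turns x_{a-1-w} ⊗ S(x_w) into x_w ⊗ S(x_{a-1-w}), since S² = 1;
      -- this is the term of Δ(x_{a-1}) at a-1-w, with the same scalar by symmetry of ψ.
      rw [antiMap_top hπ hπ2, explicitComul_top hπ, map_sum, map_sum,
        ← Equiv.sum_comp D.complEquiv]
      refine Finset.sum_congr rfl fun w _ => ?_
      rw [map_smul, map_smul, TensorProduct.comm_tmul, TensorProduct.map_tmul,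
        antiMap_antiMap hπ hπ2, ← vec_complEquiv, complEquiv_complEquiv, vec_complEquiv,
        natPairing_compl_comm h]
    · have h3 : permV hπ hπ2 v ≠ D.bot := by
        rw [← permV_bot hπ hπ2]; exact fun h' => h1 ((permV hπ hπ2).injective h')
      have h4 : permV hπ hπ2 v ≠ D.top := by
        rw [← permV_top hπ hπ2]; exact fun h' => h2 ((permV hπ hπ2).injective h')
      rw [explicitComul_of_ne h1 h2, antiMap_mon_vec hπ hπ2, map_smul, explicitComul_of_ne h3 h4]
      simp only [map_add, TensorProduct.comm_tmul, TensorProduct.map_tmul, antiMap_one,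
        antiMap_mon_vec hπ hπ2, TensorProduct.tmul_smul, TensorProduct.smul_tmul', smul_add]
      rw [add_comm]

/-- The explicit bi-Frobenius structure attached to a compatible involution. -/
noncomputable def explicitBiFrobenius [CharP K 2] (h : ∀ i, D.nakayamaScalar i = 1)
    (hπ : D.IsCompatible π) (hπ2 : π * π = 1) : BiFrobeniusStructure K D.Alg where
  toCoalgebra := explicitCoalgebra hπ hπ2
  φ := D.topDual
  t := D.mon (D.vec D.top)
  S := D.antiMap hπ
  S_eq := antiMap_eq_tensorContract hπ
  counit_one := explicitCounit_one
  counit_mul := explicitCounit_mul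
  comul_one := D.explicitComul_one π
  frobenius := D.isFrobeniusHom_topDual
  -- Contracting Δ(t) with ψ(- S(a)) gives S(S(a)) = a.
  cofrobenius a := ⟨D.topDual ∘ₗ LinearMap.mulRight K (D.antiMap hπ a), by
    rw [← antiMap_antiMap hπ hπ2 a]
    conv_rhs => rw [antiMap_eq_tensorContract hπ]
    rw [antiMap_antiMap hπ hπ2 a]
    rfl⟩
  S_one := antiMap_one hπ
  S_mul := antiMap_mul hπ
  counit_S := explicitCounit_antiMap hπ hπ2
  comul_S := explicitComul_antiMap h hπ hπ2

theorem isPermutationAntipode_explicitBiFrobenius [CharP K 2]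
    (h : ∀ i, D.nakayamaScalar i = 1) (hπ : D.IsCompatible π) (hπ2 : π * π = 1) :
    D.IsPermutationAntipode (explicitBiFrobenius h hπ hπ2) :=
  ⟨permV hπ hπ2, fun v => D.antipodeCoeff π 1 (D.vec v), antiMap_mon_vec hπ hπ2⟩

end QCIData

/-! ### The characterization in characteristic 2 -/

theorem corollary6p4 {K : Type*} [Field K] [CharP K 2] {n : ℕ} (D : QCIData K n) :
    (D.AdmitsPermutationBiFrobenius ↔
      D.CanonicalNakayamaSqEqId ∧
        ∃ π : Equiv.Perm (Fin n), D.IsCompatible π ∧ π * π = 1) ∧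
    (D.AdmitsPermutationBiFrobenius →
      IsBimoduleSymmetric K D.Alg ∧
      ∀ π : Equiv.Perm (Fin n), D.IsCompatible π → π * π = 1 →
        ∃ B : BiFrobeniusStructure K D.Alg,
          B.φ = D.topDual ∧
          B.t = D.mon (D.vec D.top) ∧
          B.counit = D.explicitCounit ∧
          B.comul = D.explicitComul π 1 ∧
          B.S = D.explicitAntipode π 1 ∧
          D.IsPermutationAntipode B ∧
          ∀ i, B.S (D.x i) = D.x (π i)) := by
  refine ⟨⟨fun h => ?_, ?_⟩, fun h => ?_⟩
  · obtain ⟨hN, hπ⟩ := D.nakayamaScalar_eq_one_and_exists_isCompatible h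
    exact ⟨D.canonicalNakayamaSqEqId hN, hπ⟩
  · rintro ⟨hN, π, hπ, hπ2⟩
    have h i := QCIData.eq_one_of_sq_eq_one (D.nakayamaScalar_sq hN i)
    exact ⟨_, QCIData.isPermutationAntipode_explicitBiFrobenius h hπ hπ2⟩
  · obtain ⟨hN, -⟩ := D.nakayamaScalar_eq_one_and_exists_isCompatible h
    refine ⟨D.isBimoduleSymmetric hN, fun π hπ hπ2 =>
      ⟨QCIData.explicitBiFrobenius hN hπ hπ2, rfl, rfl, rfl, rfl,
        (QCIData.explicitAntipode_eq hπ).symm,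
        QCIData.isPermutationAntipode_explicitBiFrobenius hN hπ hπ2, fun i => ?_⟩⟩
    exact QCIData.antiMap_x hπ i
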